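/- Let $K$ be a field and $Q$ a finite acyclic quiver. For an arrow $\alpha$ write $s(\alpha)$, $t(\alpha)$ for its source and target. Let $\overline Q$ be the double quiver, obtained by adding an arrow $\alpha^*:t(\alpha)\to s(\alpha)$ for every arrow $\alpha$ of $Q$. Let $\Pi(Q)=K\overline Q/\langle\sum_{\alpha\in Q_1}(\alpha\alpha^*-\alpha^*\alpha)\rangle$ be the preprojective algebra (the product $pq$ of paths means first $p$, then $q$), graded by $\deg\alpha=0$, $\deg\alpha^*=1$. Write $e_i$ for the idempotent of a vertex $i$. Let $W_Q$ be the Coxeter group of $Q$, with generators $s_i$ ($i\in Q_0$) and relations $s_i^2=1$, $s_is_j=s_js_i$ if there is no arrow between $i$ and $j$, and $s_is_js_i=s_js_is_j$ if there is exactly one. For $w\in W_Q$ with reduced expression $w=s_{i_1}\cdots s_{i_r}$ put $I_w=I_{i_1}\cdots I_{i_r}$, where $I_i=\Pi(Q)(1-e_i)\Pi(Q)$, and $\Pi(Q)_w=\Pi(Q)/I_w$, a graded algebra. Let $i$ be a sink of $Q$ (no arrow starts at $i$), and let $Q'=\sigma_i(Q)$ be the quiver obtained by replacing every arrow $\alpha$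 ending at $i$ by an arrow $\alpha':i\to s(\alpha)$. Then $s_j\mapsto s_j$ ($j\in Q_0$) defines an isomorphism $W_Q\cong W_{Q'}$, which maps reduced expressions to reduced expressions; we use it to regard $w\in W_Q$ as an element of $W_{Q'}$. For every $w\in W_Q$ and every reduced expression of $w$ (used to form both ideals $I_w$), the algebras $A=\Pi(Q)_w$ and $B=\Pi(Q')_w$ satisfy the following, where modules are right modules. 1. Let $P=e_iA(1)\oplus(1-e_i)A$, where $M(1)_n=M_{n+1}$. Then $\operatorname{End}_A(P)\cong B$ as graded $K$-algebras, where $\operatorname{End}_A(P)_n=\{f\mid f(P_k)\subseteq P_{k+n}\text{ for all }k\}$. 2. $A$ and $B$ are graded Morita equivalent: there is a $K$-linear equivalence $\operatorname{Mod}^{\mathbb Z}A\simeq\operatorname{Mod}^{\mathbb Z}B$ between the categories of all graded modules that commutes, up to isomorphism, with the degree shift $(1)$. 3. There is a $K$-linear equivalence of triangulated categories $\underline{\mathsf{CM}}^{\mathbb Z}A\simeq\underline{\mathsf{CM}}^{\mathbb Z}B$. Here $\mathsf{CM}^{\mathbb Z}A$ is the category of finitely generated graded $A$-modules $M$ with $\operatorname{Ext}^k_A(M,A)=0$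 for all $k>0$, and $\underline{\mathsf{CM}}^{\mathbb Z}A=\mathsf{CM}^{\mathbb Z}A/[\operatorname{proj}^{\mathbb Z}A]$ is its quotient by the ideal of morphisms factoring through finitely generated graded projective modules. Its triangulated structure is the usual one: $[-1]$ is the syzygy functor $\Omega$, and the distinguished triangles (written $\Omega Z\to X\to Y\to Z$) are those isomorphic to the ones induced by short exact sequences in $\mathsf{CM}^{\mathbb Z}A$. An equivalence of triangulated categories is an equivalence commuting with the (de)suspension up to a natural isomorphism, compatibly with which it preserves distinguished triangles. -/

import Mathlib

universe u

open CategoryTheory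

noncomputable section

namespace Reflection

/-! ### Quivers, double quivers, sinks, reflections -/

section Quivers

variable {V : Type u}

/-- The double quiver: it has the arrows `α : a ⟶ b` of `Q` (left summand) and, for every arrow
`α : b ⟶ a` of `Q`, a reversed arrow `α* : a ⟶ b` (right summand). -/
@[reducible] def doubleQuiver (Q : Quiver.{u} V) : Quiver.{u} V :=
  ⟨fun a b => Q.Hom a b ⊕ Q.Hom b a⟩

/-- A quiver is acyclic if every path from a vertex to itself is trivial. -/
def IsAcyclic (Q : Quiver.{u} V) : Prop :=
  ∀ (a : V) (p : @Quiver.Path V Q a a), p = @Quiver.Path.nil V Q a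

/-- The vertex `i` is a sink if no arrow starts at `i`. -/
def IsSink (Q : Quiver.{u} V) (i : V) : Prop :=
  ∀ b : V, IsEmpty (Q.Hom i b)

/-- The reflection of `Q` at `i`: the arrows of `Q` that do not end at `i`, together with an arrow
`α' : i ⟶ s(α)` for every arrow `α` of `Q` that ends at `i`. -/
@[reducible] def sinkReflection (Q : Quiver.{u} V) (i : V) : Quiver.{u} V :=
  ⟨fun a b => {_α : Q.Hom a b // b ≠ i} ⊕ {_α : Q.Hom b a // a = i}⟩

/-! ### The Coxeter group of a quiver -/

open Classical in
/-- The Coxeter matrix of `Q`: the entry at `a ≠ b` is `2` if there is no arrow between `a` and `b`,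
`3` if there is exactly one, and `0` (no relation) if there are at least two. -/
def coxeterMatrix (Q : Quiver.{u} V) : CoxeterMatrix V where
  M := fun a b =>
    if a = b then 1
    else if Nat.card (Q.Hom a b ⊕ Q.Hom b a) = 0 then 2
    else if Nat.card (Q.Hom a b ⊕ Q.Hom b a) = 1 then 3
    else 0
  isSymm := by
    refine Matrix.IsSymm.ext fun a b => ?_
    have h : Nat.card (Q.Hom a b ⊕ Q.Hom b a) = Nat.card (Q.Hom b a ⊕ Q.Hom a b) :=
      Nat.card_congr (Equiv.sumComm _ _)
    simp only [h, eq_comm (a := a) (b := b)]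
  diagonal := by simp
  off_diagonal := by
    intro a b hab
    simp only [hab, if_false]
    split_ifs <;> simp

/-- The Coxeter group `W_Q`. -/
abbrev CoxeterGroup (Q : Quiver.{u} V) : Type u := (coxeterMatrix Q).Group

/-- The word `ω = [i₁, …, iᵣ]` is a reduced expression `w = s_{i₁} ⋯ s_{iᵣ}` of `w ∈ W_Q`. -/
def IsReducedExpression (Q : Quiver.{u} V) (w : CoxeterGroup Q) (ω : List V) : Prop :=
  (coxeterMatrix Q).toCoxeterSystem.wordProd ω = w ∧
    (coxeterMatrix Q).toCoxeterSystem.IsReduced ω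

end Quivers

/-! ### Path algebras -/

section PathAlgebra

variable {V : Type u} (K : Type u) [Field K] (Q : Quiver.{u} V)

/-- The set of all paths of `Q` (trivial ones included). -/
abbrev AllPaths : Type u := Σ a b : V, @Quiver.Path V Q a b

/-- The underlying vector space of the path algebra `KQ`, with basis the paths of `Q`. -/
def PathAlgebra : Type u := AllPaths Q →₀ K

instance : AddCommGroup (PathAlgebra K Q) := inferInstanceAs (AddCommGroup (AllPaths Q →₀ K))

instance : Module K (PathAlgebra K Q) := inferInstanceAs (Module K (AllPaths Q →₀ K))

/-- A path, as an element of the path algebra. -/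
def ofPath (p : AllPaths Q) : PathAlgebra K Q := Finsupp.single p 1

open Classical in
/-- The product of two paths `p`, `q` is the concatenation "first `p`, then `q`" if `p` ends where
`q` starts, and zero otherwise. -/
def pathMul (p q : AllPaths Q) : PathAlgebra K Q :=
  if h : p.2.1 = q.1 then
    ofPath K Q ⟨p.1, q.2.1, @Quiver.Path.comp V Q _ _ _ p.2.2
      (cast (congrArg (fun v => @Quiver.Path V Q v q.2.1) h.symm) q.2.2)⟩
  else 0

/-- The linear map on the path algebra with prescribed values on paths. -/
def pathLift {M : Type*} [AddCommGroup M] [Module K M] (f : AllPaths Q → M) :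
    PathAlgebra K Q →ₗ[K] M :=
  Finsupp.lift M K (AllPaths Q) f

/-- The bilinear extension of the product of paths. -/
def mulLin : PathAlgebra K Q →ₗ[K] PathAlgebra K Q →ₗ[K] PathAlgebra K Q :=
  pathLift K Q fun p => pathLift K Q fun q => pathMul K Q p q

/-- The trivial path at the vertex `v`. -/
def vertexIdem (v : V) : PathAlgebra K Q := ofPath K Q ⟨v, v, @Quiver.Path.nil V Q v⟩

/-- An arrow, as an element of the path algebra. -/
def ofArrow {a b : V} (α : Q.Hom a b) : PathAlgebra K Q :=
  ofPath K Q ⟨a, b, @Quiver.Hom.toPath V Q a b α⟩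

variable {K Q}

lemma pathLift_ofPath {M : Type*} [AddCommGroup M] [Module K M] (f : AllPaths Q → M)
    (p : AllPaths Q) : pathLift K Q f (ofPath K Q p) = f p := by
  have h : (Finsupp.lift M K (AllPaths Q) f) (Finsupp.single p 1) = f p := by simp
  exact h

lemma mulLin_ofPath (p q : AllPaths Q) :
    mulLin K Q (ofPath K Q p) (ofPath K Q q) = pathMul K Q p q := by
  rw [mulLin, pathLift_ofPath, pathLift_ofPath]

lemma pathAlgebra_hom_ext {M : Type*} [AddCommGroup M] [Module K M]
    {f g : PathAlgebra K Q →ₗ[K] M} (h : ∀ p, f (ofPath K Q p) = g (ofPath K Q p)) : f = g :=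
  Finsupp.lhom_ext' fun p => LinearMap.ext_ring (h p)

lemma pathMul_of_eq {a b c : V} (p : @Quiver.Path V Q a b) (q : @Quiver.Path V Q b c) :
    pathMul K Q ⟨a, b, p⟩ ⟨b, c, q⟩ = ofPath K Q ⟨a, c, @Quiver.Path.comp V Q _ _ _ p q⟩ := by
  simp [pathMul]

lemma pathMul_of_ne {a b c d : V} (p : @Quiver.Path V Q a b) (q : @Quiver.Path V Q c d)
    (h : b ≠ c) : pathMul K Q ⟨a, b, p⟩ ⟨c, d, q⟩ = 0 := by
  simp [pathMul, h]

lemma mulLin_assoc (x y z : PathAlgebra K Q) :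
    mulLin K Q (mulLin K Q x y) z = mulLin K Q x (mulLin K Q y z) := by
  have key : (mulLin K Q).compr₂ (mulLin K Q) =
      ((LinearMap.llcomp K (PathAlgebra K Q) (PathAlgebra K Q) (PathAlgebra K Q)).comp
        (mulLin K Q)).compl₂ (mulLin K Q) := by
    refine pathAlgebra_hom_ext fun p => pathAlgebra_hom_ext fun q => pathAlgebra_hom_ext fun r => ?_
    simp only [LinearMap.compr₂_apply, LinearMap.compl₂_apply, LinearMap.comp_apply,
      LinearMap.llcomp_apply, mulLin_ofPath]
    obtain ⟨a, b, p⟩ := p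
    obtain ⟨c, d, q⟩ := q
    obtain ⟨e, f, r⟩ := r
    by_cases h1 : b = c
    · subst h1
      by_cases h2 : d = e
      · subst h2
        simp only [pathMul_of_eq, mulLin_ofPath, Quiver.Path.comp_assoc]
      · simp only [pathMul_of_eq, pathMul_of_ne _ _ h2, mulLin_ofPath, map_zero]
    · by_cases h2 : d = e
      · subst h2
        simp only [pathMul_of_eq, pathMul_of_ne _ _ h1, mulLin_ofPath, map_zero,
          LinearMap.zero_apply]
      · simp only [pathMul_of_ne _ _ h1, pathMul_of_ne _ _ h2, map_zero, LinearMap.zero_apply]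
  have := LinearMap.congr_fun (LinearMap.congr_fun (LinearMap.congr_fun key x) y) z
  simpa using this

instance : Mul (PathAlgebra K Q) := ⟨fun x y => mulLin K Q x y⟩

lemma mul_eq_mulLin (x y : PathAlgebra K Q) : x * y = mulLin K Q x y := rfl

section One

variable [Fintype V]

/-- The unit of the path algebra is the sum of the trivial paths. -/
instance : One (PathAlgebra K Q) := ⟨∑ v : V, vertexIdem K Q v⟩

lemma one_eq : (1 : PathAlgebra K Q) = ∑ v : V, vertexIdem K Q v := rfl

lemma mulLin_one_left (x : PathAlgebra K Q) : mulLin K Q 1 x = x := by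
  have key : mulLin K Q 1 = LinearMap.id := by
    refine pathAlgebra_hom_ext fun p => ?_
    obtain ⟨a, b, p⟩ := p
    rw [one_eq, map_sum, LinearMap.sum_apply, Finset.sum_eq_single a]
    · rw [vertexIdem, mulLin_ofPath, pathMul_of_eq, Quiver.Path.nil_comp]; rfl
    · intro v _ hv
      rw [vertexIdem, mulLin_ofPath, pathMul_of_ne _ _ hv]
    · simp
  rw [key]; rfl

lemma mulLin_one_right (x : PathAlgebra K Q) : mulLin K Q x 1 = x := by
  have key : (mulLin K Q).flip 1 = LinearMap.id := by
    refine pathAlgebra_hom_ext fun p => ?_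
    obtain ⟨a, b, p⟩ := p
    rw [LinearMap.flip_apply, one_eq, map_sum, Finset.sum_eq_single b]
    · rw [vertexIdem, mulLin_ofPath, pathMul_of_eq, Quiver.Path.comp_nil]; rfl
    · intro v _ hv
      rw [vertexIdem, mulLin_ofPath, pathMul_of_ne _ _ (Ne.symm hv)]
    · simp
  exact LinearMap.congr_fun key x

instance : Ring (PathAlgebra K Q) :=
  { (inferInstance : AddCommGroup (PathAlgebra K Q)),
    (inferInstance : Mul (PathAlgebra K Q)),
    (inferInstance : One (PathAlgebra K Q)) with
    left_distrib := fun x y z => map_add (mulLin K Q x) y z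
    right_distrib := fun x y z => by
      simp only [mul_eq_mulLin, map_add, LinearMap.add_apply]
    zero_mul := fun x => by simp only [mul_eq_mulLin, map_zero, LinearMap.zero_apply]
    mul_zero := fun x => by simp only [mul_eq_mulLin, map_zero]
    mul_assoc := mulLin_assoc
    one_mul := mulLin_one_left
    mul_one := mulLin_one_right }

instance : Algebra K (PathAlgebra K Q) :=
  Algebra.ofModule
    (fun r x y => by simp only [mul_eq_mulLin, map_smul, LinearMap.smul_apply])
    (fun r x y => by simp only [mul_eq_mulLin, map_smul])

end One

end PathAlgebra

/-! ### Graded algebras: quotients by homogeneous ideals -/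

section Graded

lemma isInternal_of_proj {K M : Type*} [Field K] [AddCommGroup M] [Module K M]
    (𝓜 : ℤ → Submodule K M) (π : ℤ → M →ₗ[K] M)
    (h1 : ∀ n, ∀ x ∈ 𝓜 n, π n x = x) (h2 : ∀ n m, m ≠ n → ∀ x ∈ 𝓜 m, π n x = 0)
    (h3 : ⨆ n, 𝓜 n = ⊤) : DirectSum.IsInternal 𝓜 := by
  rw [DirectSum.isInternal_submodule_iff_iSupIndep_and_iSup_eq_top]
  refine ⟨fun n => ?_, h3⟩
  rw [Submodule.disjoint_def]
  intro x hx hx'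
  have hle : (⨆ m, ⨆ (_ : m ≠ n), 𝓜 m) ≤ LinearMap.ker (π n) :=
    iSup_le fun m => iSup_le fun hm y hy => h2 n m hm y hy
  rw [← h1 n x hx]
  exact hle hx'

variable {K A : Type u} [Field K] [Ring A] [Algebra K A] (𝓐 : ℤ → Submodule K A)

/-- An ideal is homogeneous if it is spanned over `K` by homogeneous elements. -/
def IsHomog (I : Ideal A) : Prop :=
  ∃ S : Set A, (∀ x ∈ S, ∃ n, x ∈ 𝓐 n) ∧ I.restrictScalars K = Submodule.span K S

/-- The grading induced on a quotient algebra. -/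
def quotientGrading (I : Ideal A) [I.IsTwoSided] (n : ℤ) : Submodule K (A ⧸ I) :=
  (𝓐 n).map (Ideal.Quotient.mkₐ K I).toLinearMap

/-- The two-sided ideal generated by a set. -/
def twoSidedSpan (S : Set A) : Ideal A := TwoSidedIdeal.asIdeal (TwoSidedIdeal.span S)

instance (S : Set A) : (twoSidedSpan S).IsTwoSided :=
  inferInstanceAs (TwoSidedIdeal.asIdeal (TwoSidedIdeal.span S)).IsTwoSided

lemma mem_twoSidedSpan {S : Set A} {x : A} : x ∈ twoSidedSpan S ↔ x ∈ TwoSidedIdeal.span S :=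
  TwoSidedIdeal.mem_asIdeal

lemma iSup_eq_top_of_graded [GradedAlgebra 𝓐] : ⨆ n, 𝓐 n = ⊤ :=
  (DirectSum.Decomposition.isInternal 𝓐).submodule_iSup_eq_top

lemma isHomog_top [GradedAlgebra 𝓐] : IsHomog 𝓐 (⊤ : Ideal A) := by
  refine ⟨{x | ∃ n, x ∈ 𝓐 n}, fun x hx => hx, ?_⟩
  rw [Submodule.restrictScalars_top, eq_comm, eq_top_iff, ← iSup_eq_top_of_graded 𝓐]
  exact iSup_le fun n x hx => Submodule.subset_span ⟨n, hx⟩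

open Pointwise in
lemma isHomog_mul [GradedAlgebra 𝓐] {I J : Ideal A} (hI : IsHomog 𝓐 I) (hJ : IsHomog 𝓐 J) :
    IsHomog 𝓐 (I * J) := by
  obtain ⟨S, hS, hIS⟩ := hI
  obtain ⟨T, hT, hJT⟩ := hJ
  refine ⟨S * T, ?_, ?_⟩
  · rintro _ ⟨x, hx, y, hy, rfl⟩
    obtain ⟨m, hm⟩ := hS x hx
    obtain ⟨n, hn⟩ := hT y hy
    exact ⟨m + n, SetLike.mul_mem_graded hm hn⟩
  · rw [← Submodule.span_mul_span, ← hIS, ← hJT]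
    apply le_antisymm
    · intro x hx
      refine Submodule.mul_induction_on (C := fun x => x ∈ I.restrictScalars K * J.restrictScalars K)
        (show x ∈ I * J from hx) ?_ ?_
      · intro m hm n hn
        exact Submodule.mul_mem_mul (show m ∈ I.restrictScalars K from hm)
          (show n ∈ J.restrictScalars K from hn)
      · intro x y hx hy
        exact add_mem hx hy
    · rw [Submodule.mul_le]
      intro m hm n hn
      have hm' : m ∈ I := hm
      have hn' : n ∈ J := hn
      have h := Ideal.mul_mem_mul hm' hn'
      exact h

open Pointwise in
lemma isHomog_twoSidedSpan [GradedAlgebra 𝓐] {S : Set A} (hS : ∀ x ∈ S, ∃ n, x ∈ 𝓐 n) :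
    IsHomog 𝓐 (twoSidedSpan S) := by
  have hH : Submodule.span K {x | ∃ n, x ∈ 𝓐 n} = ⊤ := by
    rw [eq_top_iff, ← iSup_eq_top_of_graded 𝓐]
    exact iSup_le fun n x hx => Submodule.subset_span ⟨n, hx⟩
  refine ⟨{x | ∃ n, x ∈ 𝓐 n} * S * {x | ∃ n, x ∈ 𝓐 n}, ?_, ?_⟩
  · rintro _ ⟨_, ⟨a, ⟨m, ha⟩, s, hs, rfl⟩, b, ⟨n, hb⟩, rfl⟩
    obtain ⟨k, hk⟩ := hS s hs
    exact ⟨m + k + n, SetLike.mul_mem_graded (SetLike.mul_mem_graded ha hk) hb⟩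
  · apply le_antisymm
    · rw [← Submodule.span_mul_span, ← Submodule.span_mul_span, hH]
      intro x hx
      have hx' : x ∈ AddSubgroup.closure (Set.univ * S * Set.univ) :=
        TwoSidedIdeal.mem_span_iff_mem_addSubgroup_closure.1 (mem_twoSidedSpan.1 hx)
      have hle : AddSubgroup.closure (Set.univ * S * Set.univ) ≤
          ((⊤ : Submodule K A) * Submodule.span K S * ⊤).toAddSubgroup := by
        rw [AddSubgroup.closure_le]
        rintro _ ⟨_, ⟨a, -, s, hs, rfl⟩, b, -, rfl⟩
        exact Submodule.mul_mem_mul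
          (Submodule.mul_mem_mul Submodule.mem_top (Submodule.subset_span hs)) Submodule.mem_top
      exact hle hx'
    · rw [Submodule.span_le]
      rintro _ ⟨_, ⟨a, -, s, hs, rfl⟩, b, -, rfl⟩
      show a * s * b ∈ twoSidedSpan S
      exact Ideal.mul_mem_right _ _ (Ideal.mul_mem_left _ _
        (mem_twoSidedSpan.2 (TwoSidedIdeal.subset_span hs)))

variable [GradedAlgebra 𝓐]

lemma proj_of_mem {n : ℤ} {x : A} (hx : x ∈ 𝓐 n) : GradedAlgebra.proj 𝓐 n x = x := by
  rw [GradedAlgebra.proj_apply, DirectSum.decompose_of_mem_same 𝓐 hx]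

lemma proj_of_mem_ne {m n : ℤ} {x : A} (hx : x ∈ 𝓐 m) (h : m ≠ n) :
    GradedAlgebra.proj 𝓐 n x = 0 := by
  rw [GradedAlgebra.proj_apply, DirectSum.decompose_of_mem_ne 𝓐 hx h]

lemma proj_mem (n : ℤ) (x : A) : GradedAlgebra.proj 𝓐 n x ∈ 𝓐 n := by
  rw [GradedAlgebra.proj_apply]
  exact SetLike.coe_mem _

variable {𝓐} in
lemma IsHomog.le_comap {I : Ideal A} (hI : IsHomog 𝓐 I) (n : ℤ) :
    I.restrictScalars K ≤ (I.restrictScalars K).comap (GradedAlgebra.proj 𝓐 n) := by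
  obtain ⟨S, hS, hIS⟩ := hI
  rw [hIS, Submodule.span_le]
  intro x hx
  obtain ⟨m, hm⟩ := hS x hx
  rw [SetLike.mem_coe, Submodule.mem_comap]
  by_cases h : m = n
  · subst h
    rw [proj_of_mem 𝓐 hm]
    exact Submodule.subset_span hx
  · rw [proj_of_mem_ne 𝓐 hm h]
    exact zero_mem _

variable {𝓐} in
lemma quotientGrading_isInternal {I : Ideal A} [I.IsTwoSided] (hI : IsHomog 𝓐 I) :
    DirectSum.IsInternal (quotientGrading 𝓐 I) := by
  let π : ℤ → (A ⧸ I) →ₗ[K] (A ⧸ I) := fun n =>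
    Submodule.mapQ (I.restrictScalars K) (I.restrictScalars K) (GradedAlgebra.proj 𝓐 n)
      (hI.le_comap n)
  have hπ : ∀ n x, π n (Ideal.Quotient.mkₐ K I x) =
      Ideal.Quotient.mkₐ K I (GradedAlgebra.proj 𝓐 n x) := fun n x => rfl
  refine isInternal_of_proj _ π ?_ ?_ ?_
  · rintro n _ ⟨x, hx, rfl⟩
    rw [AlgHom.toLinearMap_apply, hπ, proj_of_mem 𝓐 hx]
  · rintro n m hmn _ ⟨x, hx, rfl⟩
    rw [AlgHom.toLinearMap_apply, hπ, proj_of_mem_ne 𝓐 hx hmn, map_zero]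
  · have h : ⨆ n, quotientGrading 𝓐 I n =
        (⨆ n, 𝓐 n).map (Ideal.Quotient.mkₐ K I).toLinearMap := (Submodule.map_iSup _ _).symm
    rw [h, iSup_eq_top_of_graded, Submodule.map_top, LinearMap.range_eq_top]
    exact Ideal.Quotient.mkₐ_surjective K I

variable {𝓐} in
/-- The quotient of a graded algebra by a homogeneous two-sided ideal is a graded algebra. -/
@[reducible] def quotientGradedAlgebra {I : Ideal A} [I.IsTwoSided] (hI : IsHomog 𝓐 I) :
    GradedAlgebra (quotientGrading 𝓐 I) :=
  { (quotientGrading_isInternal hI).chooseDecomposition with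
    one_mem := ⟨1, SetLike.one_mem_graded 𝓐, map_one (Ideal.Quotient.mkₐ K I)⟩
    mul_mem := by
      rintro m n _ _ ⟨x, hx, rfl⟩ ⟨y, hy, rfl⟩
      exact ⟨x * y, SetLike.mul_mem_graded hx hy, map_mul (Ideal.Quotient.mkₐ K I) x y⟩ }

end Graded

/-! ### Preprojective algebras and their truncations -/

section Preprojective

variable {V : Type u} (K : Type u) [Field K] (Q : Quiver.{u} V)

/-- The degree of a path of the double quiver: the number of its arrows of the form `α*`. -/
def pathDegree (p : AllPaths (doubleQuiver Q)) : ℤ :=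
  @Quiver.Path.addWeight V (doubleQuiver Q) ℤ _ (fun e => Sum.elim (fun _ => 0) (fun _ => 1) e)
    _ _ p.2.2

/-- The grading of the path algebra of the double quiver: the `n`-th component is spanned by the
paths of degree `n`. -/
def doubleGrading (n : ℤ) : Submodule K (PathAlgebra K (doubleQuiver Q)) :=
  Submodule.span K (ofPath K (doubleQuiver Q) '' {p | pathDegree Q p = n})

variable {K Q}

lemma ofPath_mem {p : AllPaths (doubleQuiver Q)} {n : ℤ} (h : pathDegree Q p = n) :
    ofPath K (doubleQuiver Q) p ∈ doubleGrading K Q n :=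
  Submodule.subset_span ⟨p, h, rfl⟩

lemma doubleGrading_isInternal : DirectSum.IsInternal (doubleGrading K Q) := by
  classical
  let π : ℤ → PathAlgebra K (doubleQuiver Q) →ₗ[K] PathAlgebra K (doubleQuiver Q) := fun n =>
    pathLift K (doubleQuiver Q) fun p =>
      if pathDegree Q p = n then ofPath K (doubleQuiver Q) p else 0
  refine isInternal_of_proj _ π ?_ ?_ ?_
  · intro n x hx
    refine LinearMap.mem_eqLocus.1 ((Submodule.span_le (p := (π n).eqLocus LinearMap.id)).2 ?_ hx)
    rintro _ ⟨p, hp, rfl⟩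
    rw [SetLike.mem_coe, LinearMap.mem_eqLocus, pathLift_ofPath,
      if_pos (show pathDegree Q p = n from hp), LinearMap.id_apply]
  · intro n m hmn x hx
    refine LinearMap.mem_ker.1 ((Submodule.span_le (p := LinearMap.ker (π n))).2 ?_ hx)
    rintro _ ⟨p, hp, rfl⟩
    rw [SetLike.mem_coe, LinearMap.mem_ker, pathLift_ofPath, if_neg]
    intro h
    exact hmn (hp.symm.trans h)
  · rw [eq_top_iff]
    intro x _
    have hx : x ∈ Submodule.span K (Set.range (ofPath K (doubleQuiver Q))) := by
      have h : Submodule.span K (Set.range (ofPath K (doubleQuiver Q))) = ⊤ :=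
        (Finsupp.basisSingleOne (R := K) (ι := AllPaths (doubleQuiver Q))).span_eq ▸ by
          congr 1
      rw [h]; trivial
    refine (Submodule.span_le.2 ?_) hx
    rintro _ ⟨p, rfl⟩
    exact Submodule.mem_iSup_of_mem _ (ofPath_mem rfl)

lemma pathDegree_nil (v : V) :
    pathDegree Q ⟨v, v, @Quiver.Path.nil V (doubleQuiver Q) v⟩ = 0 := by
  simp [pathDegree]

variable [Fintype V]

instance : GradedAlgebra (doubleGrading K Q) :=
  { doubleGrading_isInternal.chooseDecomposition with
    one_mem := by
      rw [one_eq]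
      exact sum_mem fun v _ => ofPath_mem (pathDegree_nil v)
    mul_mem := by
      intro m n x y hx hy
      have h : doubleGrading K Q m * doubleGrading K Q n ≤ doubleGrading K Q (m + n) := by
        rw [doubleGrading, doubleGrading, Submodule.span_mul_span, Submodule.span_le]
        rintro _ ⟨_, ⟨⟨a, b, p⟩, hp, rfl⟩, _, ⟨⟨c, d, q⟩, hq, rfl⟩, rfl⟩
        show ofPath K (doubleQuiver Q) ⟨a, b, p⟩ * ofPath K (doubleQuiver Q) ⟨c, d, q⟩ ∈
          doubleGrading K Q (m + n)
        rw [mul_eq_mulLin, mulLin_ofPath]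
        by_cases hbc : b = c
        · subst hbc
          rw [pathMul_of_eq]
          refine ofPath_mem ?_
          rw [← show pathDegree Q _ = m from hp, ← show pathDegree Q _ = n from hq]
          exact @Quiver.Path.addWeight_comp V (doubleQuiver Q) ℤ _ _ _ _ _ p q
        · rw [pathMul_of_ne _ _ hbc]
          exact zero_mem _
      exact h (Submodule.mul_mem_mul hx hy) }

variable (K Q)

/-- The arrow `α` of `Q`, as an element of the path algebra of the double quiver. -/
def arrow {a b : V} (α : Q.Hom a b) : PathAlgebra K (doubleQuiver Q) :=
  ofArrow K (doubleQuiver Q) (a := a) (b := b) (Sum.inl α)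

/-- The reversed arrow `α*`, as an element of the path algebra of the double quiver. -/
def arrowStar {a b : V} (α : Q.Hom a b) : PathAlgebra K (doubleQuiver Q) :=
  ofArrow K (doubleQuiver Q) (a := b) (b := a) (Sum.inr α)

/-- The element `∑_α (α α* - α* α)`, the sum being over all arrows `α` of the finite quiver `Q`. -/
def preprojectiveRelation : PathAlgebra K (doubleQuiver Q) :=
  ∑ᶠ α : (Σ a b : V, Q.Hom a b),
    (arrow K Q α.2.2 * arrowStar K Q α.2.2 - arrowStar K Q α.2.2 * arrow K Q α.2.2)

/-- The ideal of the path algebra of the double quiver that defines the preprojective algebra. -/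
def preprojectiveIdeal : Ideal (PathAlgebra K (doubleQuiver Q)) :=
  twoSidedSpan {preprojectiveRelation K Q}

instance : (preprojectiveIdeal K Q).IsTwoSided :=
  inferInstanceAs (twoSidedSpan _).IsTwoSided

/-- The preprojective algebra `Π(Q)`. -/
abbrev Preprojective : Type u := PathAlgebra K (doubleQuiver Q) ⧸ preprojectiveIdeal K Q

/-- The grading of `Π(Q)`. -/
def preprojectiveGrading : ℤ → Submodule K (Preprojective K Q) :=
  quotientGrading (doubleGrading K Q) (preprojectiveIdeal K Q)

lemma preprojectiveRelation_mem : preprojectiveRelation K Q ∈ doubleGrading K Q 1 := by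
  have h0 : ∀ {a b : V} (α : Q.Hom a b), arrow K Q α ∈ doubleGrading K Q 0 := fun α =>
    ofPath_mem (by simp [pathDegree, Quiver.Hom.toPath])
  have h1 : ∀ {a b : V} (α : Q.Hom a b), arrowStar K Q α ∈ doubleGrading K Q 1 := fun α =>
    ofPath_mem (by simp [pathDegree, Quiver.Hom.toPath])
  refine finsum_induction (· ∈ doubleGrading K Q 1) (zero_mem _) (fun _ _ => add_mem) ?_
  rintro ⟨a, b, α⟩
  refine sub_mem ?_ ?_
  · simpa using SetLike.mul_mem_graded (h0 α) (h1 α)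
  · simpa using SetLike.mul_mem_graded (h1 α) (h0 α)

instance : GradedAlgebra (preprojectiveGrading K Q) :=
  quotientGradedAlgebra (isHomog_twoSidedSpan _ (by
    rintro _ rfl
    exact ⟨1, preprojectiveRelation_mem K Q⟩))

/-- The idempotent `e_v` of `Π(Q)`. -/
def idem (v : V) : Preprojective K Q :=
  Ideal.Quotient.mkₐ K (preprojectiveIdeal K Q) (vertexIdem K (doubleQuiver Q) v)

lemma idem_mem (v : V) : idem K Q v ∈ preprojectiveGrading K Q 0 :=
  ⟨_, ofPath_mem (pathDegree_nil v), rfl⟩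

/-- The ideal `I_ω = I_{i₁} ⋯ I_{iᵣ}` of `Π(Q)` for a word `ω = [i₁, …, iᵣ]`, where
`I_i = Π(Q) (1 - e_i) Π(Q)`. If `ω` is a reduced expression of `w ∈ W_Q`, this is `I_w`. -/
def wordIdeal : List V → Ideal (Preprojective K Q)
  | [] => ⊤
  | i :: ω => twoSidedSpan {1 - idem K Q i} * wordIdeal ω

instance wordIdeal_isTwoSided : ∀ ω : List V, (wordIdeal K Q ω).IsTwoSided
  | [] => inferInstanceAs (⊤ : Ideal (Preprojective K Q)).IsTwoSided
  | i :: ω =>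
    haveI := wordIdeal_isTwoSided ω
    inferInstanceAs (twoSidedSpan {1 - idem K Q i} * wordIdeal K Q ω).IsTwoSided

lemma wordIdeal_isHomog : ∀ ω : List V, IsHomog (preprojectiveGrading K Q) (wordIdeal K Q ω)
  | [] => isHomog_top _
  | i :: ω => isHomog_mul _ (isHomog_twoSidedSpan _ (by
      rintro _ rfl
      exact ⟨0, sub_mem (SetLike.one_mem_graded _) (idem_mem K Q i)⟩)) (wordIdeal_isHomog ω)

/-- The truncated preprojective algebra `Π(Q)_w = Π(Q) / I_w`, where `ω` is a reduced expression
of `w`. -/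
abbrev Truncated (ω : List V) : Type u := Preprojective K Q ⧸ wordIdeal K Q ω

/-- The grading of the truncated preprojective algebra. -/
def truncatedGrading (ω : List V) : ℤ → Submodule K (Truncated K Q ω) :=
  quotientGrading (preprojectiveGrading K Q) (wordIdeal K Q ω)

instance (ω : List V) : GradedAlgebra (truncatedGrading K Q ω) :=
  quotientGradedAlgebra (wordIdeal_isHomog K Q ω)

/-- The idempotent `e_v` of the truncated preprojective algebra. -/
def truncatedIdem (ω : List V) (v : V) : Truncated K Q ω :=
  Ideal.Quotient.mkₐ K (wordIdeal K Q ω) (idem K Q v)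

lemma truncatedIdem_mem (ω : List V) (v : V) :
    truncatedIdem K Q ω v ∈ truncatedGrading K Q ω 0 :=
  ⟨_, idem_mem K Q v, rfl⟩

end Preprojective

/-! ### Graded right modules -/

section Modules

variable {K A : Type u} [Field K] [Ring A] [Algebra K A]

/-- A graded right module over the algebra `A` with grading `𝓐`. Right `A`-modules are modules
over the opposite algebra `Aᵐᵒᵖ`, so that `MulOpposite.op a • x` is the product `x a`. -/
structure GrMod (𝓐 : ℤ → Submodule K A) where
  carrier : Type u
  [addCommGroup : AddCommGroup carrier]
  [moduleK : Module K carrier]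
  [moduleA : Module Aᵐᵒᵖ carrier]
  [isScalarTower : IsScalarTower K Aᵐᵒᵖ carrier]
  gr : ℤ → Submodule K carrier
  isInternal : DirectSum.IsInternal gr
  smul_mem : ∀ {m n : ℤ} {a : A} {x : carrier}, a ∈ 𝓐 m → x ∈ gr n →
    MulOpposite.op a • x ∈ gr (n + m)

namespace GrMod

variable {𝓐 : ℤ → Submodule K A}

instance : CoeSort (GrMod 𝓐) (Type u) := ⟨GrMod.carrier⟩

attribute [instance] addCommGroup moduleK moduleA isScalarTower

/-- The homogeneous components of the elements of a graded module. -/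
def proj (M : GrMod 𝓐) (n : ℤ) : M →ₗ[K] M :=
  letI := M.isInternal.chooseDecomposition
  (M.gr n).subtype ∘ₗ DirectSum.component K ℤ (fun k => M.gr k) n ∘ₗ
    (DirectSum.decomposeLinearEquiv M.gr).toLinearMap

lemma proj_of_mem (M : GrMod 𝓐) {n : ℤ} {x : M} (hx : x ∈ M.gr n) : M.proj n x = x := by
  let _ := M.isInternal.chooseDecomposition
  exact DirectSum.decompose_of_mem_same M.gr hx

lemma proj_of_mem_ne (M : GrMod 𝓐) {m n : ℤ} {x : M} (hx : x ∈ M.gr m) (h : m ≠ n) :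
    M.proj n x = 0 := by
  let _ := M.isInternal.chooseDecomposition
  exact DirectSum.decompose_of_mem_ne M.gr hx h

lemma proj_mem (M : GrMod 𝓐) (n : ℤ) (x : M) : M.proj n x ∈ M.gr n := by
  let _ := M.isInternal.chooseDecomposition
  exact SetLike.coe_mem (DirectSum.decompose M.gr x n)

lemma iSup_gr (M : GrMod 𝓐) : ⨆ n, M.gr n = ⊤ :=
  M.isInternal.submodule_iSup_eq_top

/-- The homomorphisms of graded modules: the `A`-linear maps `f` with `f(M_n) ⊆ N_n`. -/
def homSubmodule (M N : GrMod 𝓐) : Submodule K (M →ₗ[Aᵐᵒᵖ] N) where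
  carrier := {f | ∀ n, ∀ x ∈ M.gr n, f x ∈ N.gr n}
  add_mem' := fun hf hg n x hx => add_mem (hf n x hx) (hg n x hx)
  zero_mem' := fun _ _ _ => zero_mem _
  smul_mem' := fun c _ hf n x hx => Submodule.smul_mem _ c (hf n x hx)

/-- The category `Mod^ℤ A` of graded right `A`-modules. -/
instance : Category (GrMod 𝓐) where
  Hom M N := homSubmodule M N
  id M := ⟨LinearMap.id, fun _ _ hx => hx⟩
  comp f g := ⟨g.1 ∘ₗ f.1, fun n x hx => g.2 n _ (f.2 n x hx)⟩

/-- The underlying `A`-linear map. -/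
def Hom.lin {M N : GrMod 𝓐} (f : M ⟶ N) : M →ₗ[Aᵐᵒᵖ] N := Subtype.val f

lemma Hom.mem {M N : GrMod 𝓐} (f : M ⟶ N) {n : ℤ} {x : M} (hx : x ∈ M.gr n) :
    Hom.lin f x ∈ N.gr n := Subtype.prop f n x hx

/-- Constructor for homomorphisms of graded modules. -/
def Hom.mk {M N : GrMod 𝓐} (f : M →ₗ[Aᵐᵒᵖ] N) (hf : ∀ n, ∀ x ∈ M.gr n, f x ∈ N.gr n) : M ⟶ N :=
  (⟨f, hf⟩ : homSubmodule M N)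

@[simp] lemma Hom.lin_mk {M N : GrMod 𝓐} (f : M →ₗ[Aᵐᵒᵖ] N)
    (hf : ∀ n, ∀ x ∈ M.gr n, f x ∈ N.gr n) : Hom.lin (Hom.mk f hf) = f := rfl

lemma Hom.ext {M N : GrMod 𝓐} {f g : M ⟶ N} (h : ∀ x, Hom.lin f x = Hom.lin g x) : f = g :=
  Subtype.ext (LinearMap.ext h)

@[simp] lemma Hom.id_lin (M : GrMod 𝓐) (x : M) : Hom.lin (𝟙 M) x = x := rfl

@[simp] lemma Hom.comp_lin {M N L : GrMod 𝓐} (f : M ⟶ N) (g : N ⟶ L) (x : M) :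
    Hom.lin (f ≫ g) x = Hom.lin g (Hom.lin f x) := rfl

instance : Preadditive (GrMod 𝓐) where
  homGroup M N := inferInstanceAs (AddCommGroup (homSubmodule M N))
  add_comp _ _ _ f f' g := Hom.ext fun x => map_add (Hom.lin g) (Hom.lin f x) (Hom.lin f' x)
  comp_add _ _ _ _ _ _ := rfl

instance : Linear K (GrMod 𝓐) where
  homModule M N := inferInstanceAs (Module K (homSubmodule M N))
  smul_comp _ _ _ r f g := Hom.ext fun x =>
    ((Hom.lin g).restrictScalars K).map_smul r (Hom.lin f x)
  comp_smul _ _ _ _ _ _ := rfl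

lemma Hom.proj_comm {M N : GrMod 𝓐} (f : M ⟶ N) (n : ℤ) (x : M) :
    N.proj n (Hom.lin f x) = Hom.lin f (M.proj n x) := by
  have hx : x ∈ ⨆ n, M.gr n := by rw [iSup_gr]; trivial
  induction hx using Submodule.iSup_induction' with
  | mem m y hy =>
    by_cases h : m = n
    · subst h; rw [proj_of_mem _ hy, proj_of_mem _ (Hom.mem f hy)]
    · rw [proj_of_mem_ne _ hy h, proj_of_mem_ne _ (Hom.mem f hy) h, map_zero]
  | zero => simp
  | add y z _ _ hy hz => simp only [map_add, hy, hz]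

/-- The degree shift `M(d)`, with `M(d)_n = M_{n + d}`. -/
def shift (d : ℤ) (M : GrMod 𝓐) : GrMod 𝓐 where
  carrier := M
  gr := fun n => M.gr (n + d)
  isInternal := by
    refine isInternal_of_proj _ (fun n => M.proj (n + d)) ?_ ?_ ?_
    · intro n x hx; exact M.proj_of_mem hx
    · intro n m hmn x hx; exact M.proj_of_mem_ne hx (by omega)
    · rw [← M.iSup_gr]
      exact (Equiv.addRight d).surjective.iSup_comp (g := M.gr)
  smul_mem := by
    intro m n a x ha hx
    have := M.smul_mem ha hx
    rwa [show n + d + m = n + m + d by ring] at this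

variable (𝓐) in
/-- The degree shift functor. -/
def shiftFunctor (d : ℤ) : GrMod 𝓐 ⥤ GrMod 𝓐 where
  obj M := M.shift d
  map {M N} f := Hom.mk (M := M.shift d) (N := N.shift d) (Hom.lin (M := M) (N := N) f)
    fun _ _ hx => Hom.mem (M := M) (N := N) f hx

/-- The direct sum of two graded modules. -/
def prod (M N : GrMod 𝓐) : GrMod 𝓐 where
  carrier := M × N
  gr := fun n => (M.gr n).prod (N.gr n)
  isInternal := by
    refine isInternal_of_proj _ (fun n => (M.proj n).prodMap (N.proj n)) ?_ ?_ ?_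
    · rintro n ⟨x, y⟩ ⟨hx, hy⟩
      exact Prod.ext (M.proj_of_mem hx) (N.proj_of_mem hy)
    · rintro n m hmn ⟨x, y⟩ ⟨hx, hy⟩
      exact Prod.ext (M.proj_of_mem_ne hx hmn) (N.proj_of_mem_ne hy hmn)
    · rw [eq_top_iff]
      rintro ⟨x, y⟩ -
      have h1 : (⨆ n, M.gr n) ≤ (⨆ n, (M.gr n).prod (N.gr n)).comap (LinearMap.inl K M N) :=
        iSup_le fun n z hz => Submodule.mem_iSup_of_mem n ⟨hz, zero_mem _⟩
      have h2 : (⨆ n, N.gr n) ≤ (⨆ n, (M.gr n).prod (N.gr n)).comap (LinearMap.inr K M N) :=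
        iSup_le fun n z hz => Submodule.mem_iSup_of_mem n ⟨zero_mem _, hz⟩
      have hx := h1 (show x ∈ ⨆ n, M.gr n by rw [iSup_gr]; trivial)
      have hy := h2 (show y ∈ ⨆ n, N.gr n by rw [iSup_gr]; trivial)
      have := add_mem (Submodule.mem_comap.1 hx) (Submodule.mem_comap.1 hy)
      simpa using this
  smul_mem := fun ha hx => ⟨M.smul_mem ha hx.1, N.smul_mem ha hx.2⟩

/-- The graded right ideal `e A` generated by an element `e` of degree `0`. -/
def rightIdeal [GradedAlgebra 𝓐] (e : A) (he : e ∈ 𝓐 0) : GrMod 𝓐 where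
  carrier := Submodule.span Aᵐᵒᵖ {e}
  gr := fun n => (𝓐 n).comap ((Submodule.span Aᵐᵒᵖ {e}).subtype.restrictScalars K)
  isInternal := by
    have hproj : ∀ n (a : A), GradedAlgebra.proj 𝓐 n (e * a) = e * GradedAlgebra.proj 𝓐 n a := by
      intro n a
      have := DirectSum.coe_decompose_mul_of_left_mem_zero 𝓐 (b := a) (j := n) he
      simpa [GradedAlgebra.proj_apply] using this
    have hmem : ∀ n, ∀ x ∈ (Submodule.span Aᵐᵒᵖ {e}).restrictScalars K,
        GradedAlgebra.proj 𝓐 n x ∈ (Submodule.span Aᵐᵒᵖ {e}).restrictScalars K := by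
      intro n x hx
      obtain ⟨a, rfl⟩ := Submodule.mem_span_singleton.1 hx
      refine Submodule.mem_span_singleton.2 ⟨MulOpposite.op (GradedAlgebra.proj 𝓐 n a.unop), ?_⟩
      exact (hproj n a.unop).symm
    refine isInternal_of_proj _ (fun n => (GradedAlgebra.proj 𝓐 n).restrict (hmem n)) ?_ ?_ ?_
    · intro n x hx
      exact Subtype.ext (Reflection.proj_of_mem 𝓐 hx)
    · intro n m hmn x hx
      exact Subtype.ext (Reflection.proj_of_mem_ne 𝓐 hx hmn)
    · rw [eq_top_iff]
      rintro ⟨x, hx⟩ -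
      obtain ⟨a, rfl⟩ := Submodule.mem_span_singleton.1 hx
      let φ : A →ₗ[K] Submodule.span Aᵐᵒᵖ {e} :=
        { toFun := fun b => ⟨e * b, Submodule.mem_span_singleton.2 ⟨MulOpposite.op b, rfl⟩⟩
          map_add' := fun b c => Subtype.ext (mul_add e b c)
          map_smul' := fun r b => Subtype.ext (mul_smul_comm r e b) }
      have h : (⨆ n, 𝓐 n) ≤ (⨆ n, (𝓐 n).comap
          ((Submodule.span Aᵐᵒᵖ {e}).subtype.restrictScalars K)).comap φ :=
        iSup_le fun n b hb => Submodule.mem_iSup_of_mem n (by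
          have := SetLike.mul_mem_graded he hb
          rw [zero_add] at this
          exact this)
      exact h (show a.unop ∈ ⨆ n, 𝓐 n by rw [iSup_eq_top_of_graded]; trivial)
  smul_mem := by
    intro m n a x ha hx
    exact SetLike.mul_mem_graded (show (x : A) ∈ 𝓐 n from hx) ha

/-- The degree `n` part of the graded algebra `End_A(M)`: the `A`-linear endomorphisms `f` of `M`
with `f(M_k) ⊆ M(n)_k = M_{k + n}` for all `k`. -/
def endGrading (M : GrMod 𝓐) (n : ℤ) : Submodule K (Module.End Aᵐᵒᵖ M) where
  carrier := {f | ∀ k, ∀ x ∈ M.gr k, f x ∈ M.gr (k + n)}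
  add_mem' := fun hf hg k x hx => add_mem (hf k x hx) (hg k x hx)
  zero_mem' := fun _ _ _ => zero_mem _
  smul_mem' := fun c _ hf k x hx => Submodule.smul_mem _ c (hf k x hx)

/-- Projective objects of `Mod^ℤ A`: graded modules with the lifting property with respect to
surjective homomorphisms of graded modules. -/
def IsGrProjective (P : GrMod 𝓐) : Prop :=
  ∀ ⦃M N : GrMod 𝓐⦄ (g : M ⟶ N) (f : P ⟶ N), Function.Surjective (Hom.lin g) →
    ∃ h : P ⟶ M, h ≫ g = f

/-- Finitely generated graded modules. -/
def IsFG (M : GrMod 𝓐) : Prop := Module.Finite Aᵐᵒᵖ M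

variable (𝓐) in
/-- The graded Cohen-Macaulay modules: the finitely generated graded right `A`-modules `M` with
`Ext^i_A(M, A) = 0` for all `i > 0`. -/
def isCM : ObjectProperty (GrMod 𝓐) := fun M =>
  M.IsFG ∧ ∀ i : ℕ, 0 < i → Subsingleton
    (Abelian.Ext (ModuleCat.of Aᵐᵒᵖ M.carrier) (ModuleCat.of Aᵐᵒᵖ A) i)

end GrMod

/-- Two graded algebras are graded Morita equivalent: there is a `K`-linear equivalence between
their categories of graded modules, commuting with the degree shift `(1)`. -/
def GradedMoritaEquivalent {B : Type u} [Ring B] [Algebra K B] (𝓐 : ℤ → Submodule K A)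
    (𝓑 : ℤ → Submodule K B) : Prop :=
  ∃ F : GrMod 𝓐 ≌ GrMod 𝓑, F.functor.Linear K ∧
    Nonempty (GrMod.shiftFunctor 𝓐 1 ⋙ F.functor ≅ F.functor ⋙ GrMod.shiftFunctor 𝓑 1)

/-! ### The stable category of graded Cohen-Macaulay modules -/

/-- The category `CM^ℤ A`. -/
abbrev CM (𝓐 : ℤ → Submodule K A) := (GrMod.isCM 𝓐).FullSubcategory

namespace CM

variable {𝓐 : ℤ → Submodule K A}

/-- The underlying `A`-linear map of a morphism of `CM^ℤ A`. -/
abbrev lin {X Y : CM 𝓐} (f : X ⟶ Y) : X.obj →ₗ[Aᵐᵒᵖ] Y.obj := GrMod.Hom.lin f.hom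

lemma hom_ext {X Y : CM 𝓐} {f g : X ⟶ Y} (h : ∀ x, lin f x = lin g x) : f = g :=
  InducedCategory.hom_ext (GrMod.Hom.ext h)

/-- The morphism `f` factors through a finitely generated graded projective module. -/
def FactorsThroughProj {X Y : CM 𝓐} (f : X ⟶ Y) : Prop :=
  ∃ (P : GrMod 𝓐) (a : X.obj ⟶ P) (b : P ⟶ Y.obj), P.IsFG ∧ P.IsGrProjective ∧ a ≫ b = f.hom

/-- The ideal `[proj^ℤ A]` of `CM^ℤ A`, generated by the morphisms that factor through a finitely
generated graded projective module. -/
def projIdeal (X Y : CM 𝓐) : Submodule K (X ⟶ Y) :=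
  Submodule.span K {f | FactorsThroughProj f}

lemma projIdeal_comp_left {X Y Z : CM 𝓐} (f : X ⟶ Y) {g : Y ⟶ Z} (hg : g ∈ projIdeal Y Z) :
    f ≫ g ∈ projIdeal X Z := by
  induction hg using Submodule.span_induction with
  | mem g hg =>
    obtain ⟨P, a, b, h1, h2, h3⟩ := hg
    refine Submodule.subset_span ⟨P, f.hom ≫ a, b, h1, h2, ?_⟩
    rw [Category.assoc, h3]; rfl
  | zero => rw [Limits.comp_zero]; exact zero_mem _
  | add g g' _ _ h h' => rw [Preadditive.comp_add]; exact add_mem h h'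
  | smul c g _ h => rw [Linear.comp_smul]; exact Submodule.smul_mem _ c h

lemma projIdeal_comp_right {X Y Z : CM 𝓐} {f : X ⟶ Y} (g : Y ⟶ Z) (hf : f ∈ projIdeal X Y) :
    f ≫ g ∈ projIdeal X Z := by
  induction hf using Submodule.span_induction with
  | mem f hf =>
    obtain ⟨P, a, b, h1, h2, h3⟩ := hf
    refine Submodule.subset_span ⟨P, a, b ≫ g.hom, h1, h2, ?_⟩
    rw [← Category.assoc, h3]; rfl
  | zero => rw [Limits.zero_comp]; exact zero_mem _
  | add f f' _ _ h h' => rw [Preadditive.add_comp]; exact add_mem h h'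
  | smul c f _ h => rw [Linear.smul_comp]; exact Submodule.smul_mem _ c h

variable (𝓐) in
/-- Two morphisms are identified in the stable category if their difference lies in the ideal
`[proj^ℤ A]`. -/
def stableRel : HomRel (CM 𝓐) := fun X Y f g => f - g ∈ projIdeal X Y

instance : Congruence (stableRel 𝓐) where
  equivalence :=
    { refl := fun f => by
        show f - f ∈ _
        rw [sub_self]; exact zero_mem _
      symm := fun {f g} h => by
        show g - f ∈ _
        rw [← neg_sub]; exact neg_mem h
      trans := fun {f g k} h h' => by
        show f - k ∈ _
        rw [← sub_add_sub_cancel f g k]; exact add_mem h h' }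
  comp_left f g g' h := by
    show f ≫ g - f ≫ g' ∈ _
    rw [← Preadditive.comp_sub]; exact projIdeal_comp_left f h
  comp_right g h := by
    show _ ≫ g - _ ≫ g ∈ _
    rw [← Preadditive.sub_comp]; exact projIdeal_comp_right g h

end CM

/-- The stable category `CM^ℤ A / [proj^ℤ A]`. -/
abbrev StableCM (𝓐 : ℤ → Submodule K A) := CategoryTheory.Quotient (CM.stableRel 𝓐)

namespace StableCM

open CM

variable {𝓐 : ℤ → Submodule K A}

lemma stableRel_add ⦃X Y : CM 𝓐⦄ (f₁ f₂ g₁ g₂ : X ⟶ Y) (h : stableRel 𝓐 f₁ f₂)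
    (h' : stableRel 𝓐 g₁ g₂) : stableRel 𝓐 (f₁ + g₁) (f₂ + g₂) := by
  show _ - _ ∈ _
  rw [add_sub_add_comm]; exact add_mem h h'

instance : Preadditive (StableCM 𝓐) := Quotient.preadditive _ stableRel_add

variable (𝓐) in
/-- The projection functor from `CM^ℤ A` to its stable category. -/
def proj : CM 𝓐 ⥤ StableCM 𝓐 := Quotient.functor (CM.stableRel 𝓐)

instance : (Quotient.functor (stableRel 𝓐)).Additive := Quotient.functor_additive _ stableRel_add

instance : Linear K (StableCM 𝓐) := Quotient.linear K (stableRel 𝓐) (fun c X Y f g h => by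
  show _ - _ ∈ _
  rw [← smul_sub]; exact Submodule.smul_mem _ c h)

lemma proj_map_eq_iff {X Y : CM 𝓐} (f g : X ⟶ Y) :
    (proj 𝓐).map f = (proj 𝓐).map g ↔ f - g ∈ projIdeal X Y :=
  Quotient.functor_map_eq_iff (stableRel 𝓐) f g

end StableCM

namespace CM

variable {𝓐 : ℤ → Submodule K A}

/-- `0 ⟶ X ⟶ Y ⟶ Z ⟶ 0` is a short exact sequence of graded modules (all of them being
Cohen-Macaulay). -/
structure IsShortExact {X Y Z : CM 𝓐} (f : X ⟶ Y) (g : Y ⟶ Z) : Prop where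
  injective : Function.Injective (lin f)
  exact : Function.Exact (lin f) (lin g)
  surjective : Function.Surjective (lin g)

variable (𝓐) in
/-- A choice, for every `Z` in `CM^ℤ A`, of a short exact sequence `0 ⟶ Ω Z ⟶ P Z ⟶ Z ⟶ 0` in
`CM^ℤ A` with `P Z` graded projective. -/
structure SyzygyChoice where
  Ω : CM 𝓐 → CM 𝓐
  P : CM 𝓐 → CM 𝓐
  ι : ∀ Z, Ω Z ⟶ P Z
  π : ∀ Z, P Z ⟶ Z
  projective : ∀ Z, (P Z).obj.IsGrProjective
  exact : ∀ Z, IsShortExact (ι Z) (π Z)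

namespace SyzygyChoice

variable (σ : SyzygyChoice 𝓐)

/-- The map `g` on syzygies is induced by `f`, that is, there is a commutative diagram
`Ω Z ⟶ P Z ⟶ Z`, `Ω Z' ⟶ P Z' ⟶ Z'` with vertical maps `g`, some `p`, and `f`. -/
def IsInduced {Z Z' : CM 𝓐} (f : Z ⟶ Z') (g : σ.Ω Z ⟶ σ.Ω Z') : Prop :=
  ∃ p : σ.P Z ⟶ σ.P Z', p ≫ σ.π Z' = σ.π Z ≫ f ∧ σ.ι Z ≫ p = g ≫ σ.ι Z'

/-- The map `h : Ω Z ⟶ X` is the connecting map of the short exact sequence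
`0 ⟶ X ⟶ Y ⟶ Z ⟶ 0` given by `f` and `g`. -/
def IsConnecting {X Y Z : CM 𝓐} (f : X ⟶ Y) (g : Y ⟶ Z) (h : σ.Ω Z ⟶ X) : Prop :=
  ∃ p : σ.P Z ⟶ Y, p ≫ g = σ.π Z ∧ σ.ι Z ≫ p = h ≫ f

end SyzygyChoice

lemma IsShortExact.lift {X Y Z W : CM 𝓐} {f : X ⟶ Y} {g : Y ⟶ Z} (h : IsShortExact f g)
    (p : W ⟶ Y) (hp : p ≫ g = 0) : ∃ q : W ⟶ X, q ≫ f = p := by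
  have hr : ∀ w, lin p w ∈ LinearMap.range (lin f) := fun w => by
    refine (h.exact _).1 ?_
    have := congrArg (fun k => lin k w) hp
    exact this
  let e := LinearEquiv.ofInjective (lin f) h.injective
  let q : W.obj →ₗ[Aᵐᵒᵖ] X.obj := e.symm.toLinearMap ∘ₗ (lin p).codRestrict _ hr
  have hq : ∀ w, lin f (q w) = lin p w := fun w => by
    have h1 : e (q w) = (lin p).codRestrict _ hr w := e.apply_symm_apply _
    exact congrArg Subtype.val h1
  refine ⟨ObjectProperty.homMk (GrMod.Hom.mk q ?_), hom_ext hq⟩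
  intro n w hw
  have h1 : lin f (X.obj.proj n (q w)) = lin f (q w) := by
    rw [← GrMod.Hom.proj_comm, hq]
    exact Y.obj.proj_of_mem (GrMod.Hom.mem p.hom hw)
  rw [← h.injective h1]
  exact GrMod.proj_mem _ _ _

namespace SyzygyChoice

variable (σ : SyzygyChoice 𝓐)

lemma exists_lift_proj {P Z : CM 𝓐} (hP : P.obj.IsGrProjective) (f : P ⟶ Z) :
    ∃ p : P ⟶ σ.P Z, p ≫ σ.π Z = f := by
  obtain ⟨p, hp⟩ := hP (σ.π Z).hom f.hom (σ.exact Z).surjective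
  exact ⟨ObjectProperty.homMk p, InducedCategory.hom_ext hp⟩

lemma exists_isInduced {Z Z' : CM 𝓐} (f : Z ⟶ Z') : ∃ g, σ.IsInduced f g := by
  obtain ⟨p, hp⟩ := σ.exists_lift_proj (σ.projective Z) (σ.π Z ≫ f)
  have h0 : σ.ι Z ≫ σ.π Z = 0 := hom_ext fun x => (σ.exact Z).exact.apply_apply_eq_zero x
  obtain ⟨g, hg⟩ := (σ.exact Z').lift (σ.ι Z ≫ p) (by
    rw [Category.assoc, hp, ← Category.assoc, h0, Limits.zero_comp])
  exact ⟨g, p, hp, hg.symm⟩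

variable {σ}

lemma IsInduced.sub {Z Z' : CM 𝓐} {f f' : Z ⟶ Z'} {g g' : σ.Ω Z ⟶ σ.Ω Z'}
    (h : σ.IsInduced f g) (h' : σ.IsInduced f' g') : σ.IsInduced (f - f') (g - g') := by
  obtain ⟨p, h1, h2⟩ := h
  obtain ⟨p', h1', h2'⟩ := h'
  exact ⟨p - p', by rw [Preadditive.sub_comp, Preadditive.comp_sub, h1, h1'],
    by rw [Preadditive.sub_comp, Preadditive.comp_sub, h2, h2']⟩

lemma IsInduced.add {Z Z' : CM 𝓐} {f f' : Z ⟶ Z'} {g g' : σ.Ω Z ⟶ σ.Ω Z'}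
    (h : σ.IsInduced f g) (h' : σ.IsInduced f' g') : σ.IsInduced (f + f') (g + g') := by
  obtain ⟨p, h1, h2⟩ := h
  obtain ⟨p', h1', h2'⟩ := h'
  exact ⟨p + p', by rw [Preadditive.add_comp, Preadditive.comp_add, h1, h1'],
    by rw [Preadditive.add_comp, Preadditive.comp_add, h2, h2']⟩

lemma IsInduced.smul {Z Z' : CM 𝓐} {f : Z ⟶ Z'} {g : σ.Ω Z ⟶ σ.Ω Z'} (c : K)
    (h : σ.IsInduced f g) : σ.IsInduced (c • f) (c • g) := by
  obtain ⟨p, h1, h2⟩ := h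
  exact ⟨c • p, by rw [Linear.smul_comp, Linear.comp_smul, h1],
    by rw [Linear.smul_comp, Linear.comp_smul, h2]⟩

lemma IsInduced.id (Z : CM 𝓐) : σ.IsInduced (𝟙 Z) (𝟙 (σ.Ω Z)) :=
  ⟨𝟙 _, by simp, by simp⟩

lemma IsInduced.comp {Z Z' Z'' : CM 𝓐} {f : Z ⟶ Z'} {f' : Z' ⟶ Z''} {g : σ.Ω Z ⟶ σ.Ω Z'}
    {g' : σ.Ω Z' ⟶ σ.Ω Z''} (h : σ.IsInduced f g) (h' : σ.IsInduced f' g') :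
    σ.IsInduced (f ≫ f') (g ≫ g') := by
  obtain ⟨p, h1, h2⟩ := h
  obtain ⟨p', h1', h2'⟩ := h'
  refine ⟨p ≫ p', ?_, ?_⟩
  · rw [Category.assoc, h1', ← Category.assoc, h1, Category.assoc]
  · rw [← Category.assoc, h2, Category.assoc, h2', Category.assoc]

lemma IsInduced.mem_of_zero {Z Z' : CM 𝓐} {g : σ.Ω Z ⟶ σ.Ω Z'} (h : σ.IsInduced 0 g) :
    g ∈ projIdeal _ _ := by
  obtain ⟨p, h1, h2⟩ := h
  obtain ⟨q, hq⟩ := (σ.exact Z').lift p (by rw [h1, Limits.comp_zero])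
  have hg : σ.ι Z ≫ q = g := by
    refine hom_ext fun x => (σ.exact Z').injective ?_
    have h3 : (σ.ι Z ≫ q) ≫ σ.ι Z' = g ≫ σ.ι Z' := by rw [Category.assoc, hq, h2]
    exact congrArg (fun k => lin k x) h3
  exact Submodule.subset_span ⟨_, (σ.ι Z).hom, q.hom, (σ.P Z).property.1, σ.projective Z,
    congrArg (fun k => k.hom) hg⟩

lemma IsInduced.mem {Z Z' : CM 𝓐} {f : Z ⟶ Z'} {g : σ.Ω Z ⟶ σ.Ω Z'} (h : σ.IsInduced f g)
    (hf : f ∈ projIdeal _ _) : g ∈ projIdeal _ _ := by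
  have key : ∃ g₀, g₀ ∈ projIdeal (σ.Ω Z) (σ.Ω Z') ∧ σ.IsInduced f g₀ := by
    clear h
    induction hf using Submodule.span_induction with
    | mem f hf =>
      obtain ⟨P, a, b, -, hP, hab⟩ := hf
      obtain ⟨c, hc⟩ := hP (σ.π Z').hom b (σ.exact Z').surjective
      refine ⟨0, zero_mem _, σ.π Z ≫ ObjectProperty.homMk (a ≫ c), ?_, ?_⟩
      · refine InducedCategory.hom_ext ?_
        show ((σ.π Z).hom ≫ a ≫ c) ≫ (σ.π Z').hom = (σ.π Z).hom ≫ f.hom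
        rw [Category.assoc, Category.assoc, hc, hab]
      · have h0 : σ.ι Z ≫ σ.π Z = 0 := hom_ext fun x => (σ.exact Z).exact.apply_apply_eq_zero x
        rw [← Category.assoc, h0, Limits.zero_comp, Limits.zero_comp]
    | zero => exact ⟨0, zero_mem _, 0, by simp, by simp⟩
    | add f f' _ _ h h' =>
      obtain ⟨g, hg, hi⟩ := h
      obtain ⟨g', hg', hi'⟩ := h'
      exact ⟨g + g', add_mem hg hg', hi.add hi'⟩
    | smul c f _ h =>
      obtain ⟨g, hg, hi⟩ := h
      exact ⟨c • g, Submodule.smul_mem _ c hg, hi.smul c⟩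
  obtain ⟨g₀, hg₀, hi⟩ := key
  have h1 := h.sub hi
  rw [sub_self] at h1
  have := add_mem h1.mem_of_zero hg₀
  rwa [sub_add_cancel] at this

lemma IsInduced.proj_map_eq {Z Z' : CM 𝓐} {f f' : Z ⟶ Z'} {g g' : σ.Ω Z ⟶ σ.Ω Z'}
    (h : σ.IsInduced f g) (h' : σ.IsInduced f' g') (hf : f - f' ∈ projIdeal _ _) :
    (StableCM.proj 𝓐).map g = (StableCM.proj 𝓐).map g' :=
  (StableCM.proj_map_eq_iff g g').2 ((h.sub h').mem hf)

variable (σ)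

/-- The syzygy functor from `CM^ℤ A` to its stable category. -/
def preSyzygyFunctor : CM 𝓐 ⥤ StableCM 𝓐 where
  obj Z := (StableCM.proj 𝓐).obj (σ.Ω Z)
  map f := (StableCM.proj 𝓐).map (σ.exists_isInduced f).choose
  map_id Z := by
    refine Eq.trans ?_ ((StableCM.proj 𝓐).map_id (σ.Ω Z))
    exact (σ.exists_isInduced _).choose_spec.proj_map_eq (IsInduced.id Z)
      (by rw [sub_self]; exact zero_mem _)
  map_comp f f' := by
    rw [← Functor.map_comp]
    exact (σ.exists_isInduced _).choose_spec.proj_map_eq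
      ((σ.exists_isInduced f).choose_spec.comp (σ.exists_isInduced f').choose_spec)
      (by rw [sub_self]; exact zero_mem _)

/-- The syzygy functor `Ω` on the stable category of graded Cohen-Macaulay modules. For an
Iwanaga-Gorenstein algebra it is an autoequivalence, and the suspension `[1]` of the triangulated
category is its quasi-inverse. -/
def syzygyFunctor : StableCM 𝓐 ⥤ StableCM 𝓐 :=
  CategoryTheory.Quotient.lift (stableRel 𝓐) σ.preSyzygyFunctor (fun _ _ f g h =>
    (σ.exists_isInduced f).choose_spec.proj_map_eq (σ.exists_isInduced g).choose_spec h)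

/-- The distinguished triangles of the stable category, written as `Ω Z ⟶ X ⟶ Y ⟶ Z` (which is the
rotation of `X ⟶ Y ⟶ Z ⟶ X[1]`, where `[-1] = Ω`): the sequences isomorphic, in the stable category,
to one given by a short exact sequence `0 ⟶ X' ⟶ Y' ⟶ Z' ⟶ 0` in `CM^ℤ A` and its connecting map
`Ω Z' ⟶ X'`. -/
def IsDistinguished {X Y Z : StableCM 𝓐} (h : σ.syzygyFunctor.obj Z ⟶ X) (u : X ⟶ Y)
    (v : Y ⟶ Z) : Prop :=
  ∃ (X' Y' Z' : CM 𝓐) (f : X' ⟶ Y') (g : Y' ⟶ Z') (k : σ.Ω Z' ⟶ X')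
    (a : X ≅ (StableCM.proj 𝓐).obj X') (b : Y ≅ (StableCM.proj 𝓐).obj Y')
    (c : Z ≅ (StableCM.proj 𝓐).obj Z'),
    IsShortExact f g ∧ σ.IsConnecting f g k ∧
    h ≫ a.hom = σ.syzygyFunctor.map c.hom ≫
      (show σ.syzygyFunctor.obj ((StableCM.proj 𝓐).obj Z') ⟶ (StableCM.proj 𝓐).obj X' from
        (StableCM.proj 𝓐).map k) ∧
    u ≫ b.hom = a.hom ≫ (StableCM.proj 𝓐).map f ∧
    v ≫ c.hom = b.hom ≫ (StableCM.proj 𝓐).map g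

end SyzygyChoice

end CM

/-- The stable categories of graded Cohen-Macaulay modules over two graded algebras are equivalent
as (`K`-linear) triangulated categories: there is a `K`-linear equivalence `F` together with an
isomorphism `θ : F ∘ Ω ≅ Ω ∘ F` (so that `F` commutes with the suspensions), such that `F` sends
distinguished triangles to distinguished triangles. It is part of the assertion that the syzygy
functors exist, i.e. that all graded Cohen-Macaulay modules have syzygies in `CM^ℤ`. -/
def StableTriangleEquivalent {B : Type u} [Ring B] [Algebra K B] (𝓐 : ℤ → Submodule K A)
    (𝓑 : ℤ → Submodule K B) : Prop :=
  ∃ (σ : CM.SyzygyChoice 𝓐) (τ : CM.SyzygyChoice 𝓑) (F : StableCM 𝓐 ≌ StableCM 𝓑)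
    (θ : σ.syzygyFunctor ⋙ F.functor ≅ F.functor ⋙ τ.syzygyFunctor),
    F.functor.Linear K ∧
    ∀ ⦃X Y Z : StableCM 𝓐⦄ (h : σ.syzygyFunctor.obj Z ⟶ X) (u : X ⟶ Y) (v : Y ⟶ Z),
      σ.IsDistinguished h u v →
        τ.IsDistinguished (θ.inv.app Z ≫ F.functor.map h) (F.functor.map u) (F.functor.map v)

end Modules

section Statement

variable {V : Type u} [Fintype V] (K : Type u) [Field K] (Q : Quiver.{u} V)

/-- The graded right module `P = e_i A(1) ⊕ (1 - e_i) A` over `A = Π(Q)_w`. -/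
def shiftedProgenerator (ω : List V) (i : V) : GrMod (truncatedGrading K Q ω) :=
  GrMod.prod
    (GrMod.shift 1 (GrMod.rightIdeal (truncatedIdem K Q ω i) (truncatedIdem_mem K Q ω i)))
    (GrMod.rightIdeal (1 - truncatedIdem K Q ω i)
      (sub_mem (SetLike.one_mem_graded _) (truncatedIdem_mem K Q ω i)))

end Statement

end Reflection

end

/-!
For a sink `i` of `Q`, the algebras `Π(Q)_w` and `Π(σ_i Q)_w` are isomorphic as ungraded algebras:
a double quiver has the same arrows after a reflection, and `α' ↦ α*`, `α'* ↦ -α` for the arrows `α`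
ending at `i` (all other arrows being fixed) maps the preprojective relation of `σ_i Q` to that of
`Q`, each idempotent `e_j` to `e_j`, and hence `I_w` to `I_w` (`reflectTruncated`).

Under this isomorphism only the degrees of arrows at `i` change. Since no arrow of `Q` starts at
`i`, the degree of an arrow `a ⟶ b` changes by `c b - c a`, where the potential `c` is `-1` at `i`
and `0` elsewhere. So an element of degree `n` of `B = Π(σ_i Q)_w` corresponds to an element of
`A = Π(Q)_w` whose corners at `e = e_i` have degrees `n`, `n`, `n + 1` and `n - 1`. This defines the
regraded algebra `regrade`; that the old grading of `B` is exactly the regraded one follows from the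
same statement for the inverse isomorphism (`mem_iff_mem_regrade`). All three claims are about this
situation, which is recorded by the structure `Regrading`.

* The regraded algebra is the endomorphism algebra of `e A(1) ⊕ (1 - e) A`, because as an ungraded
  module this is `A`, and its degree-`k` part consists of the `a` with `e a` of degree `k + 1` and
  `(1 - e) a` of degree `k` (`endEquiv_mem_iff`).
* A graded `A`-module becomes a graded `B`-module on the same underlying module by shifting the
  degrees on `M e` (`Regrading.equivalence`). This has an inverse of the same kind and commutes with
  `(1)`.
* As the underlying modules do not change, the equivalence preserves finite generation, the
  vanishing of `Ext`, short exact sequences and projectivity, so that it induces an equivalence of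
  stable categories. A choice of syzygies for `A` is carried to one for `B`, with respect to which
  the equivalence is one of triangulated categories (`CM.SyzygyChoice.IsDistinguished.transport`).
  Syzygies exist because `A` is finite-dimensional: the double quiver has no loops, so every arrow
  lies in every `I_j`, and a path that is at least as long as `w` vanishes in `A`
  (`finite_truncated`). Therefore `A` is Noetherian, kernels of graded free covers are finitely
  generated, and they are Cohen-Macaulay by dimension shifting (`nonempty_syzygyChoice`).

The Coxeter matrix of a quiver depends only on the numbers of arrows between two vertices in either
direction, which do not change under reflection.
-/

noncomputable section

namespace Reflection

/-! ### Homomorphisms of path algebras -/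

section PathEval

variable {V : Type u} {K : Type u} [Field K] {Q : Quiver.{u} V} {R : Type u} [Ring R] [Algebra K R]

/-- The value of a path under an assignment of elements of a ring `R` to the vertices and the
arrows. -/
def pathEval (e : V → R) (x : ∀ a b : V, Q.Hom a b → R) {a : V} :
    ∀ {b : V}, @Quiver.Path V Q a b → R
  | _, .nil => e a
  | _, .cons p α => pathEval e x p * x _ _ α

variable {e : V → R} {x : ∀ a b : V, Q.Hom a b → R}

lemma left_mul_pathEval (he : ∀ a, e a * e a = e a) {a b : V} (p : @Quiver.Path V Q a b) :
    e a * pathEval e x p = pathEval e x p := by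
  induction p with
  | nil => exact he a
  | cons p α ih => simp only [pathEval]; rw [← mul_assoc, ih]

lemma pathEval_mul_right (he : ∀ a, e a * e a = e a) (hr : ∀ a b α, x a b α * e b = x a b α)
    {a b : V} (p : @Quiver.Path V Q a b) : pathEval e x p * e b = pathEval e x p := by
  cases p with
  | nil => exact he a
  | cons p α => simp only [pathEval]; rw [mul_assoc, hr]

lemma pathEval_comp (he : ∀ a, e a * e a = e a) (hr : ∀ a b α, x a b α * e b = x a b α)
    {a b c : V} (p : @Quiver.Path V Q a b) (q : @Quiver.Path V Q b c) :
    pathEval e x (@Quiver.Path.comp V Q _ _ _ p q) = pathEval e x p * pathEval e x q := by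
  induction q with
  | nil => exact (pathEval_mul_right he hr p).symm
  | cons q α ih => simp only [Quiver.Path.comp_cons, pathEval]; rw [ih, mul_assoc]

/-- A path from `a` to `b` is homogeneous of its weight, corrected by a potential `c` on the
vertices, if this holds for the arrows. -/
lemma pathEval_mem (𝓡 : ℤ → Submodule K R) [SetLike.GradedMul 𝓡] {c : V → ℤ}
    (w : ∀ {a b : V}, Q.Hom a b → ℤ) (he : ∀ a, e a ∈ 𝓡 0)
    (hx : ∀ a b α, x a b α ∈ 𝓡 (w α + c b - c a)) {a b : V} (p : @Quiver.Path V Q a b) :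
    pathEval e x p ∈ 𝓡 (@Quiver.Path.addWeight V Q ℤ _ w a b p + c b - c a) := by
  induction p with
  | nil => simpa [pathEval] using he a
  | cons p α ih =>
    have := SetLike.mul_mem_graded ih (hx _ _ α)
    rw [show ∀ s t y z : ℤ, s + t - y + (z + c _ - t) = s + z + c _ - y by intros; ring] at this
    rw [Quiver.Path.addWeight_cons]
    exact this

lemma vertexIdem_mul_self (v : V) : vertexIdem K Q v * vertexIdem K Q v = vertexIdem K Q v := by
  rw [vertexIdem, mul_eq_mulLin, mulLin_ofPath, pathMul_of_eq]
  rfl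

lemma vertexIdem_mul_of_ne {v w : V} (h : v ≠ w) : vertexIdem K Q v * vertexIdem K Q w = 0 := by
  rw [vertexIdem, vertexIdem, mul_eq_mulLin, mulLin_ofPath, pathMul_of_ne _ _ h]

lemma vertexIdem_mul_ofArrow {a b : V} (α : Q.Hom a b) :
    vertexIdem K Q a * ofArrow K Q α = ofArrow K Q α := by
  rw [vertexIdem, ofArrow, mul_eq_mulLin, mulLin_ofPath, pathMul_of_eq, Quiver.Path.nil_comp]

lemma ofArrow_mul_vertexIdem {a b : V} (α : Q.Hom a b) :
    ofArrow K Q α * vertexIdem K Q b = ofArrow K Q α := by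
  rw [vertexIdem, ofArrow, mul_eq_mulLin, mulLin_ofPath, pathMul_of_eq, Quiver.Path.comp_nil]

lemma ofPath_cons {a b c : V} (p : @Quiver.Path V Q a b) (α : Q.Hom b c) :
    ofPath K Q ⟨a, c, .cons p α⟩ = ofPath K Q ⟨a, b, p⟩ * ofArrow K Q α := by
  rw [ofArrow, mul_eq_mulLin, mulLin_ofPath, pathMul_of_eq]
  rfl

variable [Fintype V]

variable (K) in
/-- The algebra homomorphism from the path algebra that is given by orthogonal idempotents `e v`
with sum `1`, one for every vertex, and elements `x α`, one for every arrow. The value at an arrow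
`α` starting at `a` is `e a * x α`, so that no condition at the source is needed. -/
def pathAlgebraHom (e : V → R) (x : ∀ a b : V, Q.Hom a b → R) (he : ∀ a, e a * e a = e a)
    (ho : ∀ a b, a ≠ b → e a * e b = 0) (h1 : ∑ a, e a = 1)
    (hr : ∀ a b α, x a b α * e b = x a b α) :
    PathAlgebra K Q →ₐ[K] R :=
  AlgHom.ofLinearMap (pathLift K Q fun p => pathEval e x p.2.2)
    (by
      rw [one_eq, map_sum, ← h1]
      exact Finset.sum_congr rfl fun v _ => pathLift_ofPath _ _)
    (by
      intro y z
      have key : (mulLin K Q).compr₂ (pathLift K Q fun p => pathEval e x p.2.2) =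
          (LinearMap.mul K R).compl₁₂ (pathLift K Q fun p => pathEval e x p.2.2)
            (pathLift K Q fun p => pathEval e x p.2.2) := by
        refine pathAlgebra_hom_ext fun p => pathAlgebra_hom_ext fun q => ?_
        rw [LinearMap.compr₂_apply, LinearMap.compl₁₂_apply, mulLin_ofPath, pathLift_ofPath,
          pathLift_ofPath, LinearMap.mul_apply']
        obtain ⟨a, b, p⟩ := p
        obtain ⟨c, d, q⟩ := q
        by_cases h : b = c
        · subst h
          rw [pathMul_of_eq, pathLift_ofPath, pathEval_comp he hr]
        · rw [pathMul_of_ne _ _ h, map_zero]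
          dsimp only
          rw [← pathEval_mul_right he hr p, ← left_mul_pathEval he q, mul_assoc,
            ← mul_assoc (e b), ho b c h, zero_mul, mul_zero]
      exact LinearMap.congr_fun (LinearMap.congr_fun key y) z)

lemma pathAlgebraHom_ofPath (he : ∀ a, e a * e a = e a)
    (ho : ∀ a b, a ≠ b → e a * e b = 0) (h1 : ∑ a, e a = 1)
    (hr : ∀ a b α, x a b α * e b = x a b α) (p : AllPaths Q) :
    pathAlgebraHom K e x he ho h1 hr (ofPath K Q p) = pathEval e x p.2.2 :=
  pathLift_ofPath _ _

lemma pathAlgebraHom_ofArrow (he : ∀ a, e a * e a = e a)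
    (ho : ∀ a b, a ≠ b → e a * e b = 0) (h1 : ∑ a, e a = 1)
    (hl : ∀ a b α, e a * x a b α = x a b α) (hr : ∀ a b α, x a b α * e b = x a b α)
    {a b : V} (α : Q.Hom a b) :
    pathAlgebraHom K e x he ho h1 hr (ofArrow K Q α) = x a b α := by
  rw [ofArrow, pathAlgebraHom_ofPath]
  exact hl a b α

lemma pathAlgebra_algHom_ext {f g : PathAlgebra K Q →ₐ[K] R}
    (hv : ∀ v, f (vertexIdem K Q v) = g (vertexIdem K Q v))
    (ha : ∀ (a b : V) (α : Q.Hom a b), f (ofArrow K Q α) = g (ofArrow K Q α)) : f = g := by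
  have key : f.toLinearMap = g.toLinearMap := by
    refine pathAlgebra_hom_ext ?_
    rintro ⟨a, b, p⟩
    simp only [AlgHom.toLinearMap_apply]
    induction p with
    | nil => exact hv a
    | cons p α ih => rw [ofPath_cons, map_mul, map_mul, ih, ha]
  exact AlgHom.toLinearMap_injective key

variable {Q' : Quiver.{u} V}

/-- The homomorphism of path algebras over the same vertices that sends an arrow `α` to the arrow
`f α`, multiplied by the scalar `ε α`. -/
def arrowHom (f : ∀ a b : V, Q.Hom a b → Q'.Hom a b) (ε : ∀ a b : V, Q.Hom a b → K) :
    PathAlgebra K Q →ₐ[K] PathAlgebra K Q' :=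
  pathAlgebraHom K (vertexIdem K Q') (fun a b α => ε a b α • ofArrow K Q' (f a b α))
    vertexIdem_mul_self (fun _ _ => vertexIdem_mul_of_ne) rfl
    (fun a b α => by rw [smul_mul_assoc, ofArrow_mul_vertexIdem])

lemma arrowHom_vertexIdem (f : ∀ a b : V, Q.Hom a b → Q'.Hom a b) (ε : ∀ a b : V, Q.Hom a b → K)
    (v : V) : arrowHom f ε (vertexIdem K Q v) = vertexIdem K Q' v :=
  pathAlgebraHom_ofPath ..

lemma arrowHom_ofArrow (f : ∀ a b : V, Q.Hom a b → Q'.Hom a b) (ε : ∀ a b : V, Q.Hom a b → K)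
    {a b : V} (α : Q.Hom a b) :
    arrowHom f ε (ofArrow K Q α) = ε a b α • ofArrow K Q' (f a b α) :=
  pathAlgebraHom_ofArrow _ _ _
    (fun a b α => by rw [mul_smul_comm, vertexIdem_mul_ofArrow]) _ α

/-- Bijections between the arrows of two quivers, twisted by non-zero scalars, define an isomorphism
of path algebras. -/
def arrowEquiv (f : ∀ a b : V, Q.Hom a b ≃ Q'.Hom a b) (ε : ∀ a b : V, Q.Hom a b → Kˣ) :
    PathAlgebra K Q ≃ₐ[K] PathAlgebra K Q' :=
  AlgEquiv.ofAlgHom (arrowHom (fun a b => f a b) (fun a b α => ε a b α))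
    (arrowHom (fun a b => (f a b).symm) (fun a b β => ((ε a b ((f a b).symm β))⁻¹ : Kˣ)))
    (pathAlgebra_algHom_ext
      (fun v => by rw [AlgHom.comp_apply, arrowHom_vertexIdem, arrowHom_vertexIdem]; rfl)
      (fun a b β => by
        rw [AlgHom.comp_apply, arrowHom_ofArrow, map_smul, arrowHom_ofArrow]
        simp [smul_smul]))
    (pathAlgebra_algHom_ext
      (fun v => by rw [AlgHom.comp_apply, arrowHom_vertexIdem, arrowHom_vertexIdem]; rfl)
      (fun a b α => by
        rw [AlgHom.comp_apply, arrowHom_ofArrow, map_smul, arrowHom_ofArrow]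
        simp [smul_smul]))

end PathEval

/-! ### Shifting the grading at an idempotent -/

section Regrade

variable {K A : Type u} [Field K] [Ring A] [Algebra K A]

/-- The grading of `A` that is obtained from `𝓐` by shifting the corners at an idempotent `e`: the
component of degree `n` consists of the `x` such that `e x e` and `(1 - e) x (1 - e)` have degree
`n`, while `e x (1 - e)` has degree `n + d` and `(1 - e) x e` has degree `n - d` in the old grading.
It is the grading of `A` as endomorphism ring of `e A(d) ⊕ (1 - e) A`. -/
def regrade (𝓐 : ℤ → Submodule K A) (e : A) (d n : ℤ) : Submodule K A where
  carrier := {x | e * x * e ∈ 𝓐 n ∧ (1 - e) * x * (1 - e) ∈ 𝓐 n ∧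
    e * x * (1 - e) ∈ 𝓐 (n + d) ∧ (1 - e) * x * e ∈ 𝓐 (n - d)}
  add_mem' := by
    rintro x y ⟨h1, h2, h3, h4⟩ ⟨h1', h2', h3', h4'⟩
    refine ⟨?_, ?_, ?_, ?_⟩ <;> rw [mul_add, add_mul] <;> apply add_mem <;> assumption
  zero_mem' := by simp
  smul_mem' := by
    rintro c x ⟨h1, h2, h3, h4⟩
    refine ⟨?_, ?_, ?_, ?_⟩ <;> rw [mul_smul_comm, smul_mul_assoc] <;>
      apply Submodule.smul_mem <;> assumption

variable {𝓐 : ℤ → Submodule K A} {e : A} {d : ℤ}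

lemma mem_regrade {n : ℤ} {x : A} : x ∈ regrade 𝓐 e d n ↔
    e * x * e ∈ 𝓐 n ∧ (1 - e) * x * (1 - e) ∈ 𝓐 n ∧
    e * x * (1 - e) ∈ 𝓐 (n + d) ∧ (1 - e) * x * e ∈ 𝓐 (n - d) := Iff.rfl

lemma corner_sum (e x : A) : e * x * e + (1 - e) * x * (1 - e) + e * x * (1 - e) +
    (1 - e) * x * e = x := by noncomm_ring

/-- If an isomorphism and its inverse shift degrees at corresponding idempotents in opposite ways,
then it identifies one grading with the regrading of the other. -/
lemma mem_iff_mem_regrade {B : Type u} [Ring B] [Algebra K B] {𝓑 : ℤ → Submodule K B} {e' : B}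
    (Φ : B ≃ₐ[K] A) (he' : IsIdempotentElem e') (hΦ : Φ e' = e)
    (h : ∀ n, ∀ b ∈ 𝓑 n, Φ b ∈ regrade 𝓐 e d n)
    (h' : ∀ n, ∀ a ∈ 𝓐 n, Φ.symm a ∈ regrade 𝓑 e' (-d) n) (n : ℤ) (b : B) :
    b ∈ 𝓑 n ↔ Φ b ∈ regrade 𝓐 e d n := by
  refine ⟨h n b, fun hb => ?_⟩
  obtain ⟨h1, h2, h3, h4⟩ := hb
  have hs : Φ.symm e = e' := by rw [← hΦ, Φ.symm_apply_apply]
  have ho : (1 - e') * (1 - e') = 1 - e' := he'.one_sub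
  have k1 := (h' _ _ h1).1
  have k2 := (h' _ _ h2).2.1
  have k3 := (h' _ _ h3).2.2.1
  have k4 := (h' _ _ h4).2.2.2
  simp only [map_mul, map_sub, map_one, hs, AlgEquiv.symm_apply_apply] at k1 k2 k3 k4
  have k1' : e' * b * e' ∈ 𝓑 n := by
    convert k1 using 1
    simp only [mul_assoc]; rw [he', ← mul_assoc e' e', he']
  have k2' : (1 - e') * b * (1 - e') ∈ 𝓑 n := by
    convert k2 using 1
    simp only [mul_assoc]; rw [ho, ← mul_assoc (1 - e') (1 - e'), ho]
  have k3' : e' * b * (1 - e') ∈ 𝓑 n := by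
    rw [show n = n + d + -d by ring]
    convert k3 using 1
    simp only [mul_assoc]; rw [ho, ← mul_assoc e' e', he']
  have k4' : (1 - e') * b * e' ∈ 𝓑 n := by
    rw [show n = n - d - -d by ring]
    convert k4 using 1
    simp only [mul_assoc]; rw [he', ← mul_assoc (1 - e') (1 - e'), ho]
  rw [← corner_sum e' b]
  exact add_mem (add_mem (add_mem k1' k2') k3') k4'

end Regrade

/-! ### Regradings of path algebras and their quotients -/

section RegradeTransfer

variable {K : Type u} [Field K]

/-- A homomorphism of graded algebras is also one for the gradings shifted at corresponding
elements. -/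
lemma map_mem_regrade {A B : Type u} [Ring A] [Algebra K A] [Ring B] [Algebra K B]
    {𝓐 : ℤ → Submodule K A} {𝓑 : ℤ → Submodule K B} (g : A →ₐ[K] B)
    (hg : ∀ n, ∀ a ∈ 𝓐 n, g a ∈ 𝓑 n) {e x : A} {d n : ℤ} (hx : x ∈ regrade 𝓐 e d n) :
    g x ∈ regrade 𝓑 (g e) d n := by
  obtain ⟨h1, h2, h3, h4⟩ := hx
  refine ⟨?_, ?_, ?_, ?_⟩
  · simpa using hg _ _ h1
  · simpa using hg _ _ h2
  · simpa using hg _ _ h3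
  · simpa using hg _ _ h4

lemma mem_quotientGrading {A : Type u} [Ring A] [Algebra K A] {𝓐 : ℤ → Submodule K A}
    {I : Ideal A} [I.IsTwoSided] {n : ℤ} {a : A} (ha : a ∈ 𝓐 n) :
    Ideal.Quotient.mkₐ K I a ∈ quotientGrading 𝓐 I n :=
  ⟨a, ha, rfl⟩

variable {V : Type u} [Fintype V] {Q Q' : Quiver.{u} V}

open Classical in
/-- A change of arrows that changes the degree of an arrow `a ⟶ b` by `c b - c a`, where the
potential `c` takes the value `-d` at `i` and vanishes elsewhere, shifts degrees at `e_i`. -/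
lemma arrowHom_mem_regrade
    (f : ∀ a b : V, (doubleQuiver Q).Hom a b → (doubleQuiver Q').Hom a b)
    (ε : ∀ a b : V, (doubleQuiver Q).Hom a b → K) (i : V) (d : ℤ)
    (hf : ∀ (a b : V) (α : (doubleQuiver Q).Hom a b),
      Sum.elim (fun _ => (0 : ℤ)) (fun _ => 1) (f a b α) =
        Sum.elim (fun _ => (0 : ℤ)) (fun _ => 1) α + (if b = i then -d else 0)
          - (if a = i then -d else 0))
    {n : ℤ} {x : PathAlgebra K (doubleQuiver Q)} (hx : x ∈ doubleGrading K Q n) :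
    arrowHom f ε x ∈ regrade (doubleGrading K Q') (vertexIdem K (doubleQuiver Q') i) d n := by
  suffices h : doubleGrading K Q n ≤ (regrade (doubleGrading K Q')
      (vertexIdem K (doubleQuiver Q') i) d n).comap (arrowHom f ε).toLinearMap from h hx
  rw [doubleGrading, Submodule.span_le]
  rintro _ ⟨⟨a, b, p⟩, rfl, rfl⟩
  rw [SetLike.mem_coe, Submodule.mem_comap, AlgHom.toLinearMap_apply, arrowHom,
    pathAlgebraHom_ofPath]
  set x : ∀ a b : V, (doubleQuiver Q).Hom a b → PathAlgebra K (doubleQuiver Q') :=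
    fun a b α => ε a b α • ofArrow K (doubleQuiver Q') (f a b α) with hxdef
  set v := vertexIdem K (doubleQuiver Q') with hv
  have hr : ∀ a b α, x a b α * v b = x a b α := fun a b α => by
    rw [hxdef]; dsimp only; rw [smul_mul_assoc, ofArrow_mul_vertexIdem]
  set z := pathEval v x p with hz
  have hza : v a * z = z := left_mul_pathEval vertexIdem_mul_self p
  have hzb : z * v b = z := pathEval_mul_right vertexIdem_mul_self hr p
  have hmem : z ∈ doubleGrading K Q' (pathDegree Q ⟨a, b, p⟩ + (if b = i then -d else 0)
      - (if a = i then -d else 0)) := by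
    refine pathEval_mem (Q := doubleQuiver Q) (doubleGrading K Q')
      (c := fun v => if v = i then -d else 0)
      (@fun a b (α : Q.Hom a b ⊕ Q.Hom b a) => Sum.elim (fun _ => 0) (fun _ => 1) α)
      (fun v => ofPath_mem (pathDegree_nil v)) (fun a b α => ?_) p
    refine Submodule.smul_mem _ _ (ofPath_mem ?_)
    simp only [pathDegree, Quiver.Hom.toPath, Quiver.Path.addWeight_cons,
      Quiver.Path.addWeight_nil, zero_add]
    exact hf a b α
  have ha : v i * z = if a = i then z else 0 := by
    split_ifs with h
    · rw [← h, hza]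
    · rw [← hza, ← mul_assoc, hv, vertexIdem_mul_of_ne (Ne.symm h), zero_mul]
  have hb : z * v i = if b = i then z else 0 := by
    split_ifs with h
    · rw [← h, hzb]
    · rw [← hzb, mul_assoc, hv, vertexIdem_mul_of_ne h, mul_zero]
  rw [mem_regrade]
  by_cases h1 : a = i <;> by_cases h2 : b = i <;>
    simp only [h1, h2, if_true, if_false] at ha hb hmem <;>
    simp only [sub_mul, mul_sub, one_mul, mul_one, zero_mul, ha, hb, sub_self, sub_zero,
      zero_mem, and_true, true_and] <;>
    convert hmem using 2 <;> ring

end RegradeTransfer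

section IdealTransfer

lemma twoSidedSpan_map {A B : Type u} [Ring A] [Ring B] (g : A →+* B) {S : Set A} {T : Set B}
    (h : ∀ s ∈ S, g s ∈ T) {x : A} (hx : x ∈ twoSidedSpan S) : g x ∈ twoSidedSpan T := by
  rw [mem_twoSidedSpan, TwoSidedIdeal.mem_span_iff] at hx
  exact mem_twoSidedSpan.2 ((TwoSidedIdeal.mem_comap g).1 (hx ((TwoSidedIdeal.span T).comap g)
    fun s hs => (TwoSidedIdeal.mem_comap g).2 (TwoSidedIdeal.subset_span (h s hs))))

lemma ideal_eq_map_of_forall_mem {K A B : Type u} [Field K] [Ring A] [Algebra K A] [Ring B]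
    [Algebra K B] (g : A ≃ₐ[K] B) {I : Ideal A} {J : Ideal B} (h : ∀ x ∈ I, g x ∈ J)
    (h' : ∀ y ∈ J, g.symm y ∈ I) : J = I.map (g : A →+* B) := by
  apply le_antisymm
  · intro y hy
    have := Ideal.mem_map_of_mem (g : A →+* B) (h' y hy)
    simpa using this
  · exact Ideal.map_le_iff_le_comap.2 fun x hx => h x hx

variable {V : Type u} [Fintype V] {K : Type u} [Field K] {Q Q' : Quiver.{u} V}

lemma map_mem_wordIdeal (g : Preprojective K Q →ₐ[K] Preprojective K Q')
    (hg : ∀ v, g (idem K Q v) = idem K Q' v) (ω : List V) :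
    ∀ x ∈ wordIdeal K Q ω, g x ∈ wordIdeal K Q' ω := by
  induction ω with
  | nil => exact fun x _ => trivial
  | cons i ω ih =>
    intro x hx
    refine Submodule.mul_induction_on (C := fun x => g x ∈ wordIdeal K Q' (i :: ω)) hx ?_ ?_
    · intro m hm n hn
      rw [map_mul]
      refine Ideal.mul_mem_mul (twoSidedSpan_map (g : Preprojective K Q →+* Preprojective K Q')
        ?_ hm) (ih n hn)
      rintro _ rfl
      simp [hg]
    · intro x y hx hy
      rw [map_add]
      exact add_mem hx hy

variable (g : PathAlgebra K (doubleQuiver Q) ≃ₐ[K] PathAlgebra K (doubleQuiver Q'))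
  (hg : g (preprojectiveRelation K Q) = preprojectiveRelation K Q')

/-- The isomorphism of preprojective algebras induced by an isomorphism of path algebras that
preserves the preprojective relations. -/
def preprojectiveEquiv : Preprojective K Q ≃ₐ[K] Preprojective K Q' :=
  Ideal.quotientEquivAlg _ _ g (ideal_eq_map_of_forall_mem g
    (fun _ => twoSidedSpan_map (S := {preprojectiveRelation K Q})
      (T := {preprojectiveRelation K Q'}) (g : _ →+* PathAlgebra K (doubleQuiver Q')) (by
        rintro _ rfl; exact hg))
    (fun _ => twoSidedSpan_map (S := {preprojectiveRelation K Q'})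
      (T := {preprojectiveRelation K Q}) (g.symm : _ →+* PathAlgebra K (doubleQuiver Q)) (by
        rintro _ rfl; exact g.symm_apply_eq.2 hg.symm)))

variable (hv : ∀ v, g (vertexIdem K (doubleQuiver Q) v) = vertexIdem K (doubleQuiver Q') v)

include hv in
lemma preprojectiveEquiv_idem (v : V) :
    preprojectiveEquiv g hg (idem K Q v) = idem K Q' v := by
  rw [idem, idem, ← hv]
  rfl

/-- The isomorphism of truncated preprojective algebras induced by an isomorphism of path algebras
that preserves the preprojective relations and the vertices. -/
def truncatedEquiv (ω : List V) : Truncated K Q ω ≃ₐ[K] Truncated K Q' ω :=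
  Ideal.quotientEquivAlg _ _ (preprojectiveEquiv g hg) (ideal_eq_map_of_forall_mem _
    (map_mem_wordIdeal (preprojectiveEquiv g hg : Preprojective K Q →ₐ[K] Preprojective K Q')
      (preprojectiveEquiv_idem g hg hv) ω)
    (map_mem_wordIdeal
      ((preprojectiveEquiv g hg).symm : Preprojective K Q' →ₐ[K] Preprojective K Q)
      (fun v => (AlgEquiv.symm_apply_eq _).2 (preprojectiveEquiv_idem g hg hv v).symm) ω))

lemma truncatedEquiv_idem (ω : List V) (v : V) :
    truncatedEquiv g hg hv ω (truncatedIdem K Q ω v) = truncatedIdem K Q' ω v := by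
  rw [truncatedIdem, truncatedIdem, ← preprojectiveEquiv_idem g hg hv]
  rfl

variable (K Q) in
/-- The projection of the path algebra of the double quiver onto the truncated preprojective
algebra. -/
def toTruncated (ω : List V) : PathAlgebra K (doubleQuiver Q) →ₐ[K] Truncated K Q ω :=
  (Ideal.Quotient.mkₐ K (wordIdeal K Q ω)).comp (Ideal.Quotient.mkₐ K (preprojectiveIdeal K Q))

lemma toTruncated_mem (ω : List V) {n : ℤ} {x : PathAlgebra K (doubleQuiver Q)}
    (hx : x ∈ doubleGrading K Q n) : toTruncated K Q ω x ∈ truncatedGrading K Q ω n :=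
  mem_quotientGrading (𝓐 := preprojectiveGrading K Q)
    (mem_quotientGrading (𝓐 := doubleGrading K Q) hx)

lemma truncatedEquiv_symm_idem (ω : List V) (v : V) :
    (truncatedEquiv g hg hv ω).symm (truncatedIdem K Q' ω v) = truncatedIdem K Q ω v :=
  (AlgEquiv.symm_apply_eq _).2 (truncatedEquiv_idem g hg hv ω v).symm

lemma truncatedEquiv_mem_regrade (ω : List V) (i : V) (d : ℤ)
    (h : ∀ n, ∀ x ∈ doubleGrading K Q n,
      g x ∈ regrade (doubleGrading K Q') (vertexIdem K (doubleQuiver Q') i) d n)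
    (n : ℤ) (b : Truncated K Q ω) (hb : b ∈ truncatedGrading K Q ω n) :
    truncatedEquiv g hg hv ω b ∈
      regrade (truncatedGrading K Q' ω) (truncatedIdem K Q' ω i) d n := by
  obtain ⟨_, ⟨x, hx, rfl⟩, rfl⟩ := hb
  exact map_mem_regrade (toTruncated K Q' ω) (fun _ _ => toTruncated_mem ω) (h n x hx)

lemma truncatedEquiv_symm_mem_regrade (ω : List V) (i : V) (d : ℤ)
    (h : ∀ n, ∀ x ∈ doubleGrading K Q' n,
      g.symm x ∈ regrade (doubleGrading K Q) (vertexIdem K (doubleQuiver Q) i) d n)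
    (n : ℤ) (b : Truncated K Q' ω) (hb : b ∈ truncatedGrading K Q' ω n) :
    (truncatedEquiv g hg hv ω).symm b ∈
      regrade (truncatedGrading K Q ω) (truncatedIdem K Q ω i) d n := by
  obtain ⟨_, ⟨x, hx, rfl⟩, rfl⟩ := hb
  exact map_mem_regrade (toTruncated K Q ω) (fun _ _ => toTruncated_mem ω) (h n x hx)

end IdealTransfer

/-! ### The reflection at a sink -/

section Reflect

variable {V : Type u} {K : Type u} [Field K] {Q : Quiver.{u} V} {i : V}

open Classical in
/-- The arrows of the double quivers of `σ_i(Q)` and `Q` correspond to each other: `α'` corresponds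
to `α*`, `α'*` to `α`, and all other arrows to themselves. -/
def reflectArrow (Q : Quiver.{u} V) (i : V) (a b : V) :
    (doubleQuiver (sinkReflection Q i)).Hom a b ≃ (doubleQuiver Q).Hom a b where
  toFun := Sum.elim (Sum.elim (fun α => .inl α.1) (fun α => .inr α.1))
    (Sum.elim (fun α => .inr α.1) (fun α => .inl α.1))
  invFun := Sum.elim
    (fun α => if h : b = i then .inr (.inr ⟨α, h⟩) else .inl (.inl ⟨α, h⟩))
    (fun α => if h : a = i then .inl (.inr ⟨α, h⟩) else .inr (.inl ⟨α, h⟩))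
  left_inv := by
    rintro ((⟨α, h⟩ | ⟨α, h⟩) | (⟨α, h⟩ | ⟨α, h⟩)) <;> simp [h]
  right_inv := by
    rintro (α | α)
    · by_cases h : b = i <;> simp [h]
    · by_cases h : a = i <;> simp [h]

/-- The sign `-1` at the arrows `α'*`, and `1` at all others. -/
def reflectSign (K : Type u) [Field K] (Q : Quiver.{u} V) (i : V) (a b : V) :
    (doubleQuiver (sinkReflection Q i)).Hom a b → Kˣ :=
  Sum.elim (fun _ => 1) (Sum.elim (fun _ => 1) (fun _ => -1))

open Classical in
lemma reflectArrow_degree (hi : IsSink Q i) (a b : V)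
    (α : (doubleQuiver (sinkReflection Q i)).Hom a b) :
    Sum.elim (fun _ => (0 : ℤ)) (fun _ => 1) (reflectArrow Q i a b α) =
      Sum.elim (fun _ => (0 : ℤ)) (fun _ => 1) α + (if b = i then -1 else 0)
        - (if a = i then -1 else 0) := by
  rcases α with (⟨α, h⟩ | ⟨α, h⟩) | (⟨α, h⟩ | ⟨α, h⟩)
  · have ha : a ≠ i := by rintro rfl; exact (hi b).false α
    simp [reflectArrow, h, ha]
  · have hb : b ≠ i := by rintro rfl; exact (hi a).false α
    simp [reflectArrow, h, hb]
  · have hb : b ≠ i := by rintro rfl; exact (hi a).false α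
    simp [reflectArrow, h, hb]
  · have ha : a ≠ i := by rintro rfl; exact (hi b).false α
    simp [reflectArrow, h, ha]

open Classical in
/-- The arrows of `σ_i(Q)` correspond to those of `Q`, the ones at `i` being reversed. -/
def reflectArrows (Q : Quiver.{u} V) (i : V) :
    (Σ a b : V, (sinkReflection Q i).Hom a b) ≃ (Σ a b : V, Q.Hom a b) where
  toFun := fun
    | ⟨a, b, .inl α⟩ => ⟨a, b, α.1⟩
    | ⟨a, b, .inr α⟩ => ⟨b, a, α.1⟩
  invFun := fun ⟨a, b, α⟩ =>
    if h : b = i then ⟨b, a, .inr ⟨α, h⟩⟩ else ⟨a, b, .inl ⟨α, h⟩⟩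
  left_inv := by
    rintro ⟨a, b, ⟨α, h⟩ | ⟨α, h⟩⟩ <;> simp [h]
  right_inv := by
    rintro ⟨a, b, α⟩
    by_cases h : b = i <;> simp [h]

variable [Fintype V]

variable (K) in
/-- The isomorphism `K(σ_i Q)¯ ≅ K Q¯` of path algebras of double quivers, given by `α' ↦ α*` and
`α'* ↦ -α` for the arrows `α` of `Q` ending at `i`. -/
def reflectEquiv (Q : Quiver.{u} V) (i : V) :
    PathAlgebra K (doubleQuiver (sinkReflection Q i)) ≃ₐ[K] PathAlgebra K (doubleQuiver Q) :=
  arrowEquiv (reflectArrow Q i) (reflectSign K Q i)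

lemma reflectEquiv_vertexIdem (v : V) :
    reflectEquiv K Q i (vertexIdem K (doubleQuiver (sinkReflection Q i)) v) =
      vertexIdem K (doubleQuiver Q) v :=
  arrowHom_vertexIdem ..

lemma reflectEquiv_ofArrow {a b : V} (α : (doubleQuiver (sinkReflection Q i)).Hom a b) :
    reflectEquiv K Q i (ofArrow K (doubleQuiver (sinkReflection Q i)) α) =
      (reflectSign K Q i a b α : K) • ofArrow K (doubleQuiver Q) (reflectArrow Q i a b α) :=
  arrowHom_ofArrow ..

/-- For an arrow `α` ending at `i`, the summand `α' α'* - α'* α'` is mapped to `-α* α + α α*`: the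
sign makes up for the exchange of `α` and `α*`. -/
lemma reflectEquiv_preprojectiveRelation [∀ a b : V, Finite (Q.Hom a b)] :
    reflectEquiv K Q i (preprojectiveRelation K (sinkReflection Q i)) =
      preprojectiveRelation K Q := by
  have hfin : ∀ a b : V, Finite ((sinkReflection Q i).Hom a b) := fun a b =>
    inferInstanceAs (Finite ({_α : Q.Hom a b // b ≠ i} ⊕ {_α : Q.Hom b a // a = i}))
  rw [preprojectiveRelation, preprojectiveRelation]
  refine ((reflectEquiv K Q i).toAddEquiv.toAddMonoidHom.map_finsum (Set.toFinite _)).trans ?_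
  refine finsum_eq_of_bijective (reflectArrows Q i) (reflectArrows Q i).bijective ?_
  rintro ⟨a, b, α | α⟩
  · show reflectEquiv K Q i _ = _
    simp only [arrow, arrowStar, map_sub, map_mul, reflectEquiv_ofArrow, reflectArrow,
      reflectSign, reflectArrows]
    simp
  · show reflectEquiv K Q i _ = _
    simp only [arrow, arrowStar, map_sub, map_mul, reflectEquiv_ofArrow, reflectArrow,
      reflectSign, reflectArrows]
    simp [sub_eq_neg_add, add_comm]

lemma reflectEquiv_mem_regrade (hi : IsSink Q i) (n : ℤ)
    (x : PathAlgebra K (doubleQuiver (sinkReflection Q i)))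
    (hx : x ∈ doubleGrading K (sinkReflection Q i) n) :
    reflectEquiv K Q i x ∈
      regrade (doubleGrading K Q) (vertexIdem K (doubleQuiver Q) i) 1 n :=
  arrowHom_mem_regrade _ _ i 1 (reflectArrow_degree hi) hx

lemma reflectEquiv_symm_mem_regrade (hi : IsSink Q i) (n : ℤ)
    (x : PathAlgebra K (doubleQuiver Q)) (hx : x ∈ doubleGrading K Q n) :
    (reflectEquiv K Q i).symm x ∈ regrade (doubleGrading K (sinkReflection Q i))
      (vertexIdem K (doubleQuiver (sinkReflection Q i)) i) (-1) n := by
  classical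
  refine arrowHom_mem_regrade _ _ i (-1) (fun a b α => ?_) hx
  have := reflectArrow_degree hi a b ((reflectArrow Q i a b).symm α)
  rw [Equiv.apply_symm_apply] at this
  rw [this]
  split_ifs <;> ring

variable (K) in
/-- The isomorphism `Π(σ_i Q)_w ≅ Π(Q)_w` of ungraded algebras. -/
def reflectTruncated (Q : Quiver.{u} V) [∀ a b : V, Finite (Q.Hom a b)] (i : V) (ω : List V) :
    Truncated K (sinkReflection Q i) ω ≃ₐ[K] Truncated K Q ω :=
  truncatedEquiv (reflectEquiv K Q i) reflectEquiv_preprojectiveRelation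
    reflectEquiv_vertexIdem ω

lemma isIdempotentElem_truncatedIdem (ω : List V) :
    IsIdempotentElem (truncatedIdem K Q ω i) := by
  have := congrArg (toTruncated K Q ω) (vertexIdem_mul_self (K := K) (Q := doubleQuiver Q) i)
  rw [map_mul] at this
  exact this

end Reflect

/-! ### Regrading modules -/

section RegradeModules

open MulOpposite

variable {K A B : Type u} [Field K] [Ring A] [Algebra K A] [Ring B] [Algebra K B]

/-- An isomorphism in `Mod^ℤ A` from a linear isomorphism that identifies the gradings. -/
def GrMod.isoMk {𝓐 : ℤ → Submodule K A} {M N : GrMod 𝓐} (l : M ≃ₗ[Aᵐᵒᵖ] N)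
    (h : ∀ n x, x ∈ M.gr n ↔ l x ∈ N.gr n) : M ≅ N where
  hom := GrMod.Hom.mk l.toLinearMap fun n x hx => (h n x).1 hx
  inv := GrMod.Hom.mk l.symm.toLinearMap fun n x hx => (h n _).2 (by simpa using hx)
  hom_inv_id := GrMod.Hom.ext l.symm_apply_apply
  inv_hom_id := GrMod.Hom.ext l.apply_symm_apply

/-- An isomorphism `Φ` of algebras that becomes an isomorphism of graded algebras after shifting
the grading by `d` at an idempotent `e` of degree `0`. -/
structure Regrading (𝓐 : ℤ → Submodule K A) (𝓑 : ℤ → Submodule K B) where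
  Φ : B ≃ₐ[K] A
  e : A
  d : ℤ
  isIdempotentElem : IsIdempotentElem e
  e_mem : e ∈ 𝓐 0
  symm_e_mem : Φ.symm e ∈ 𝓑 0
  map_mem : ∀ n, ∀ b ∈ 𝓑 n, Φ b ∈ regrade 𝓐 e d n
  symm_map_mem : ∀ n, ∀ a ∈ 𝓐 n, Φ.symm a ∈ regrade 𝓑 (Φ.symm e) (-d) n

namespace Regrading

variable {𝓐 : ℤ → Submodule K A} {𝓑 : ℤ → Submodule K B} (R : Regrading 𝓐 𝓑)

/-- The inverse regrading. -/
def symm : Regrading 𝓑 𝓐 where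
  Φ := R.Φ.symm
  e := R.Φ.symm R.e
  d := -R.d
  isIdempotentElem := by
    rw [IsIdempotentElem, ← map_mul, R.isIdempotentElem]
  e_mem := R.symm_e_mem
  symm_e_mem := by simpa using R.e_mem
  map_mem := R.symm_map_mem
  symm_map_mem := by simpa using R.map_mem

lemma map_mem_iff (n : ℤ) (b : B) : b ∈ 𝓑 n ↔ R.Φ b ∈ regrade 𝓐 R.e R.d n :=
  mem_iff_mem_regrade R.Φ R.symm.isIdempotentElem (R.Φ.apply_symm_apply _) R.map_mem
    R.symm_map_mem n b

lemma symm_symm : R.symm.symm = R := by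
  obtain ⟨Φ, e, d, _, _, _, _, _⟩ := R
  simp [symm]

lemma e_smul_e_smul {M : GrMod 𝓐} (x : M) : op R.e • op R.e • x = op R.e • x := by
  rw [smul_smul, ← op_mul, R.isIdempotentElem]

lemma e_smul_one_sub_smul {M : GrMod 𝓐} (x : M) : op R.e • op (1 - R.e) • x = 0 := by
  rw [smul_smul, ← op_mul, sub_mul, one_mul, R.isIdempotentElem, sub_self, op_zero, zero_smul]

lemma one_sub_smul_e_smul {M : GrMod 𝓐} (x : M) : op (1 - R.e) • op R.e • x = 0 := by
  rw [smul_smul, ← op_mul, mul_sub, mul_one, R.isIdempotentElem, sub_self, op_zero, zero_smul]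

lemma one_sub_smul_one_sub_smul {M : GrMod 𝓐} (x : M) :
    op (1 - R.e) • op (1 - R.e) • x = op (1 - R.e) • x := by
  rw [smul_smul, ← op_mul, R.isIdempotentElem.one_sub]

lemma e_smul_add_one_sub_smul {M : GrMod 𝓐} (x : M) : op R.e • x + op (1 - R.e) • x = x := by
  rw [← add_smul, ← MulOpposite.op_add, add_sub_cancel, op_one, one_smul]

/-- The grading of `M` that is shifted on `M e`. -/
def gr (M : GrMod 𝓐) (n : ℤ) : Submodule K M where
  carrier := {x | op R.e • x ∈ M.gr (n - R.d) ∧ op (1 - R.e) • x ∈ M.gr n}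
  add_mem' := by
    rintro x y ⟨h1, h2⟩ ⟨h1', h2'⟩
    exact ⟨by rw [smul_add]; exact add_mem h1 h1', by rw [smul_add]; exact add_mem h2 h2'⟩
  zero_mem' := by simp
  smul_mem' := by
    rintro c x ⟨h1, h2⟩
    exact ⟨by rw [smul_comm]; exact Submodule.smul_mem _ c h1,
      by rw [smul_comm]; exact Submodule.smul_mem _ c h2⟩

lemma e_smul_mem_gr {M : GrMod 𝓐} {n : ℤ} {x : M} (hx : x ∈ M.gr n) :
    op R.e • x ∈ R.gr M (n + R.d) := by
  refine ⟨?_, ?_⟩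
  · rw [R.e_smul_e_smul, add_sub_cancel_right]
    simpa using M.smul_mem R.e_mem hx
  · rw [R.one_sub_smul_e_smul]
    exact zero_mem _

lemma smul_mem_gr {M : GrMod 𝓐} {m n : ℤ} {a : A} {x : M} (ha : a ∈ regrade 𝓐 R.e R.d m)
    (hx : x ∈ R.gr M n) : op a • x ∈ R.gr M (n + m) := by
  obtain ⟨h1, h2, h3, h4⟩ := ha
  obtain ⟨k1, k2⟩ := hx
  have h12 := R.isIdempotentElem
  have h12' := R.isIdempotentElem.one_sub
  refine ⟨?_, ?_⟩
  · have : op R.e • op a • x = op (R.e * a * R.e) • op R.e • x +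
        op ((1 - R.e) * a * R.e) • op (1 - R.e) • x := by
      rw [smul_smul, smul_smul, smul_smul, ← op_mul, ← op_mul, ← op_mul, ← add_smul,
        ← MulOpposite.op_add, mul_assoc R.e a, ← mul_assoc R.e R.e, h12, mul_assoc (1 - R.e) a,
        ← mul_assoc (1 - R.e) (1 - R.e), h12', ← add_mul, add_sub_cancel, one_mul]
    rw [this]
    refine add_mem ?_ ?_
    · rw [show n + m - R.d = n - R.d + m by ring]
      exact M.smul_mem h1 k1
    · rw [show n + m - R.d = n + (m - R.d) by ring]
      exact M.smul_mem h4 k2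
  · have : op (1 - R.e) • op a • x = op (R.e * a * (1 - R.e)) • op R.e • x +
        op ((1 - R.e) * a * (1 - R.e)) • op (1 - R.e) • x := by
      rw [smul_smul, smul_smul, smul_smul, ← op_mul, ← op_mul, ← op_mul, ← add_smul,
        ← MulOpposite.op_add, mul_assoc R.e a, ← mul_assoc R.e R.e, h12, mul_assoc (1 - R.e) a,
        ← mul_assoc (1 - R.e) (1 - R.e), h12', ← add_mul, add_sub_cancel, one_mul]
    rw [this]
    refine add_mem ?_ ?_
    · rw [show n + m = n - R.d + (m + R.d) by ring]
      exact M.smul_mem h3 k1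
    · exact M.smul_mem h2 k2

variable [GradedAlgebra 𝓐]

lemma one_sub_e_mem : 1 - R.e ∈ 𝓐 0 := sub_mem (SetLike.one_mem_graded 𝓐) R.e_mem

lemma one_sub_smul_mem_gr {M : GrMod 𝓐} {n : ℤ} {x : M} (hx : x ∈ M.gr n) :
    op (1 - R.e) • x ∈ R.gr M n := by
  refine ⟨?_, ?_⟩
  · rw [R.e_smul_one_sub_smul]
    exact zero_mem _
  · rw [R.one_sub_smul_one_sub_smul]
    simpa using M.smul_mem R.one_sub_e_mem hx

lemma gr_isInternal (M : GrMod 𝓐) : DirectSum.IsInternal (R.gr M) := by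
  refine isInternal_of_proj _ (fun n =>
    M.proj (n - R.d) ∘ₗ DistribSMul.toLinearMap K M (op R.e) +
      M.proj n ∘ₗ DistribSMul.toLinearMap K M (op (1 - R.e))) ?_ ?_ ?_
  · rintro n x ⟨h1, h2⟩
    simp only [LinearMap.add_apply, LinearMap.comp_apply, DistribSMul.toLinearMap_apply]
    rw [M.proj_of_mem h1, M.proj_of_mem h2, R.e_smul_add_one_sub_smul]
  · rintro n m hmn x ⟨h1, h2⟩
    simp only [LinearMap.add_apply, LinearMap.comp_apply, DistribSMul.toLinearMap_apply]
    rw [M.proj_of_mem_ne h1 (by omega), M.proj_of_mem_ne h2 hmn, add_zero]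
  · rw [eq_top_iff, ← M.iSup_gr]
    refine iSup_le fun n x hx => ?_
    rw [← R.e_smul_add_one_sub_smul x]
    exact add_mem (Submodule.mem_iSup_of_mem _ (R.e_smul_mem_gr hx))
      (Submodule.mem_iSup_of_mem _ (R.one_sub_smul_mem_gr hx))

/-- A graded `A`-module `M`, regarded as a `B`-module along `Φ : B ≃ A` and graded by shifting
`M e`. -/
def obj (M : GrMod 𝓐) : GrMod 𝓑 :=
  letI : Module Bᵐᵒᵖ M.carrier := Module.compHom M.carrier (R.Φ : B →+* A).op
  { carrier := M.carrier
    isScalarTower := ⟨fun c b x => by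
      show op (R.Φ (c • b.unop)) • x = c • (op (R.Φ b.unop) • x)
      rw [map_smul, op_smul, smul_assoc]⟩
    gr := R.gr M
    isInternal := R.gr_isInternal M
    smul_mem := fun {_ _ b _} hb hx => R.smul_mem_gr (R.map_mem _ b hb) hx }

/-- The functor `Mod^ℤ A ⥤ Mod^ℤ B` of a regrading. -/
def functor : GrMod 𝓐 ⥤ GrMod 𝓑 where
  obj M := R.obj M
  map {M N} f := GrMod.Hom.mk (M := R.obj M) (N := R.obj N)
    { toFun := GrMod.Hom.lin f
      map_add' := map_add (GrMod.Hom.lin f)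
      map_smul' := fun b x => (GrMod.Hom.lin f).map_smul (op (R.Φ b.unop)) x }
    (fun n x hx => by
      refine ⟨?_, ?_⟩
      · have := GrMod.Hom.mem f hx.1
        rwa [(GrMod.Hom.lin f).map_smul (op R.e) (show M.carrier from x)] at this
      · have := GrMod.Hom.mem f hx.2
        rwa [(GrMod.Hom.lin f).map_smul (op (1 - R.e)) (show M.carrier from x)] at this)

instance : R.functor.Additive where

instance : R.functor.Linear K where

lemma mem_symm_gr_gr (M : GrMod 𝓐) (n : ℤ) (x : M) :
    x ∈ M.gr n ↔ x ∈ R.symm.gr (R.obj M) n := by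
  have h1 : R.Φ R.symm.e = R.e := R.Φ.apply_symm_apply R.e
  have h2 : R.Φ (1 - R.symm.e) = 1 - R.e := by rw [map_sub, map_one, h1]
  have key : x ∈ R.symm.gr (R.obj M) n ↔
      op R.e • x ∈ R.gr M (n + R.d) ∧ op (1 - R.e) • x ∈ R.gr M n := by
    rw [← h2, ← h1, ← sub_neg_eq_add n R.d]
    exact Iff.rfl
  rw [key]
  refine ⟨fun h => ⟨R.e_smul_mem_gr h, R.one_sub_smul_mem_gr h⟩, fun ⟨h, h'⟩ => ?_⟩
  rw [← R.e_smul_add_one_sub_smul x]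
  refine add_mem ?_ ?_
  · have := h.1
    rwa [R.e_smul_e_smul, add_sub_cancel_right] at this
  · have := h'.2
    rwa [R.one_sub_smul_one_sub_smul] at this

variable [GradedAlgebra 𝓑]

/-- Regrading back and forth does not change a graded module. -/
def unitApp (M : GrMod 𝓐) : M ≅ R.symm.functor.obj (R.functor.obj M) :=
  GrMod.isoMk (M := M) (N := R.symm.functor.obj (R.functor.obj M))
    { toFun := fun x => x
      invFun := fun x => x
      map_add' := fun _ _ => rfl
      map_smul' := fun a x => by
        show a • x = op (R.Φ (R.Φ.symm a.unop)) • x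
        rw [AlgEquiv.apply_symm_apply, op_unop]
      left_inv := fun _ => rfl
      right_inv := fun _ => rfl }
    (R.mem_symm_gr_gr M)

/-- Regrading back and forth, in the other order, does not change a graded module. -/
def counitApp (M : GrMod 𝓑) : R.functor.obj (R.symm.functor.obj M) ≅ M :=
  GrMod.isoMk (M := R.functor.obj (R.symm.functor.obj M)) (N := M)
    { toFun := fun x => x
      invFun := fun x => x
      map_add' := fun _ _ => rfl
      map_smul' := fun b x => by
        show op (R.Φ.symm (R.Φ b.unop)) • (show M.carrier from x) = b • (show M.carrier from x)
        rw [AlgEquiv.symm_apply_apply, op_unop]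
      left_inv := fun _ => rfl
      right_inv := fun _ => rfl }
    fun n x => by
      have := R.symm.mem_symm_gr_gr M n x
      rw [symm_symm] at this
      exact this.symm

/-- The equivalence `Mod^ℤ A ≌ Mod^ℤ B` of a regrading. -/
def equivalence : GrMod 𝓐 ≌ GrMod 𝓑 :=
  CategoryTheory.Equivalence.mk R.functor R.symm.functor
    (NatIso.ofComponents R.unitApp fun _ => rfl)
    (NatIso.ofComponents R.counitApp fun _ => rfl)

lemma gradedMoritaEquivalent (R : Regrading 𝓐 𝓑) : GradedMoritaEquivalent 𝓐 𝓑 := by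
  refine ⟨R.equivalence, inferInstanceAs (R.functor.Linear K), ⟨NatIso.ofComponents (fun M =>
    GrMod.isoMk (M := R.functor.obj (M.shift 1)) (N := (R.functor.obj M).shift 1)
      { toFun := fun x => x
        invFun := fun x => x
        map_add' := fun _ _ => rfl
        map_smul' := fun _ _ => rfl
        left_inv := fun _ => rfl
        right_inv := fun _ => rfl }
      fun n (x : M.carrier) => ?_) fun _ => rfl⟩⟩
  show (op R.e • x ∈ M.gr (n - R.d + 1) ∧ op (1 - R.e) • x ∈ M.gr (n + 1)) ↔
    (op R.e • x ∈ M.gr (n + 1 - R.d) ∧ op (1 - R.e) • x ∈ M.gr (n + 1))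
  rw [sub_add_eq_add_sub]

end Regrading

end RegradeModules

/-! ### Regrading Cohen-Macaulay modules -/

section RegradeCM

open MulOpposite

lemma ext_subsingleton_of_iso {C : Type*} [Category C] [Abelian C] [HasExt.{u} C] {X X' Y Y' : C}
    (f : X' ≅ X) (g : Y ≅ Y') (n : ℕ) [Subsingleton (Abelian.Ext X Y n)] :
    Subsingleton (Abelian.Ext X' Y' n) := by
  refine subsingleton_of_forall_eq 0 fun x => ?_
  have h : ((Abelian.Ext.mk₀ f.inv).comp x (zero_add n)).comp (Abelian.Ext.mk₀ g.inv)
      (add_zero n) = 0 := Subsingleton.elim _ _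
  have h2 : (Abelian.Ext.mk₀ f.inv).comp x (zero_add n) = 0 := by
    have := congrArg (fun y => y.comp (Abelian.Ext.mk₀ g.hom) (add_zero n)) h
    simpa using this
  have := congrArg (fun y => (Abelian.Ext.mk₀ f.hom).comp y (zero_add n)) h2
  simpa using this

/-- The equivalence of module categories given by a ring isomorphism preserves the vanishing of
`Ext`. -/
lemma ext_subsingleton_of_ringEquiv {R S : Type u} [Ring R] [Ring S] (e : R ≃+* S)
    (X Y X' Y' : Type u) [AddCommGroup X] [AddCommGroup Y] [AddCommGroup X'] [AddCommGroup Y']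
    [Module S X] [Module S Y] [Module R X'] [Module R Y'] (f : X' ≃+ X)
    (hf : ∀ (r : R) x, f (r • x) = e r • f x) (g : Y ≃+ Y')
    (hg : ∀ (r : R) y, g (e r • y) = r • g y) (n : ℕ)
    [Subsingleton (Abelian.Ext (ModuleCat.of S X) (ModuleCat.of S Y) n)] :
    Subsingleton (Abelian.Ext (ModuleCat.of R X') (ModuleCat.of R Y') n) := by
  have := ((ModuleCat.restrictScalars
    e.toRingHom).mapExt_bijective_of_preservesProjectiveObjects
      (ModuleCat.of S X) (ModuleCat.of S Y) n).surjective.subsingleton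
  let f' : X' ≃ₗ[R] (ModuleCat.restrictScalars e.toRingHom).obj (ModuleCat.of S X) :=
    { f with map_smul' := hf }
  let g' : (ModuleCat.restrictScalars e.toRingHom).obj (ModuleCat.of S Y) ≃ₗ[R] Y' :=
    { g with map_smul' := hg }
  exact ext_subsingleton_of_iso f'.toModuleIso g'.toModuleIso n

variable {K A B : Type u} [Field K] [Ring A] [Algebra K A] [Ring B] [Algebra K B]

namespace Regrading

variable {𝓐 : ℤ → Submodule K A} {𝓑 : ℤ → Submodule K B} (R : Regrading 𝓐 𝓑)
  [GradedAlgebra 𝓐]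

lemma isFG_obj {M : GrMod 𝓐} (hM : M.IsFG) : (R.obj M).IsFG := by
  obtain ⟨S, hfin, hS⟩ := Submodule.fg_def.1 hM.fg_top
  refine ⟨Submodule.fg_def.2 ⟨show Set M.carrier from S, hfin, ?_⟩⟩
  have key : ∀ x : M.carrier, x ∈ Submodule.span Aᵐᵒᵖ S →
      (show (R.obj M).carrier from x) ∈
        Submodule.span Bᵐᵒᵖ (M := (R.obj M).carrier) S := by
    intro x hx
    induction hx using Submodule.span_induction with
    | mem x hx => exact Submodule.subset_span hx
    | zero => exact zero_mem _
    | add x y _ _ hx hy => exact add_mem hx hy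
    | smul a x _ hx =>
      have h : op (R.Φ.symm a.unop) • (show (R.obj M).carrier from x) = a • x := by
        show op (R.Φ (R.Φ.symm a.unop)) • x = a • x
        rw [AlgEquiv.apply_symm_apply, op_unop]
      have := Submodule.smul_mem (Submodule.span Bᵐᵒᵖ (M := (R.obj M).carrier) S)
        (op (R.Φ.symm a.unop)) hx
      exact h ▸ this
  exact eq_top_iff.2 fun x _ => key x (by rw [hS]; trivial)

lemma isCM_obj {M : GrMod 𝓐} (hM : GrMod.isCM 𝓐 M) : GrMod.isCM 𝓑 (R.obj M) := by
  refine ⟨R.isFG_obj hM.1, fun n hn => ?_⟩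
  have := hM.2 n hn
  exact ext_subsingleton_of_ringEquiv (R.Φ : B ≃+* A).op M.carrier A (R.obj M).carrier B
    (AddEquiv.refl M.carrier) (fun _ _ => rfl) R.Φ.symm.toAddEquiv (fun b x => by
      show R.Φ.symm (x * R.Φ b.unop) = R.Φ.symm x * b.unop
      rw [map_mul, AlgEquiv.symm_apply_apply]) n

/-- Regrading of Cohen-Macaulay modules. -/
def cmFunctor : CM 𝓐 ⥤ CM 𝓑 :=
  (GrMod.isCM 𝓑).lift ((GrMod.isCM 𝓐).ι ⋙ R.functor) fun M => R.isCM_obj M.property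

instance : R.cmFunctor.Additive where

instance : R.cmFunctor.Linear K where

variable [GradedAlgebra 𝓑]

/-- The equivalence `CM^ℤ A ≌ CM^ℤ B` of a regrading. -/
def cmEquivalence : CM 𝓐 ≌ CM 𝓑 :=
  CategoryTheory.Equivalence.mk R.cmFunctor R.symm.cmFunctor
    (NatIso.ofComponents (fun M => (GrMod.isCM 𝓐).isoMk (R.unitApp M.obj)) fun _ => rfl)
    (NatIso.ofComponents (fun M => (GrMod.isCM 𝓑).isoMk (R.counitApp M.obj)) fun _ => rfl)

lemma isGrProjective_obj {P : GrMod 𝓐} (hP : P.IsGrProjective) :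
    (R.functor.obj P).IsGrProjective := by
  intro M N g f hg
  obtain ⟨h, hh⟩ := hP (R.symm.functor.map g) ((R.unitApp P).hom ≫ R.symm.functor.map f) hg
  refine ⟨R.functor.map h ≫ (R.counitApp M).hom, GrMod.Hom.ext fun x => ?_⟩
  show GrMod.Hom.lin (h ≫ R.symm.functor.map g) (show P.carrier from x) =
    GrMod.Hom.lin ((R.unitApp P).hom ≫ R.symm.functor.map f) (show P.carrier from x)
  rw [hh]

lemma factorsThroughProj_map {X Y : CM 𝓐} {f : X ⟶ Y} (hf : CM.FactorsThroughProj f) :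
    CM.FactorsThroughProj (R.cmFunctor.map f) := by
  obtain ⟨P, a, b, h1, h2, h3⟩ := hf
  exact ⟨R.functor.obj P, R.functor.map a, R.functor.map b, R.isFG_obj h1,
    R.isGrProjective_obj h2, (R.functor.map_comp a b).symm.trans (congrArg R.functor.map h3)⟩

end Regrading

end RegradeCM

/-! ### The stable category under an equivalence -/

section Transport

variable {K A B : Type u} [Field K] [Ring A] [Algebra K A] [Ring B] [Algebra K B]
  {𝓐 : ℤ → Submodule K A} {𝓑 : ℤ → Submodule K B}

lemma comp_square {C : Type*} [Category C] {X₁ X₂ X₃ X₄ Y₁ Y₂ : C} {t : X₁ ⟶ X₂} {h : X₂ ⟶ X₃}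
    {a : X₃ ⟶ X₄} {c : X₂ ⟶ Y₂} {c' : X₁ ⟶ Y₁} {t' : Y₁ ⟶ Y₂} {k : Y₂ ⟶ X₄}
    (h₁ : c' ≫ t' = t ≫ c) (h₂ : h ≫ a = c ≫ k) : (t ≫ h) ≫ a = c' ≫ t' ≫ k := by
  rw [Category.assoc, h₂, ← Category.assoc, ← h₁, Category.assoc]

namespace StableCM

open CM

lemma map_mem_projIdeal (F : CM 𝓐 ⥤ CM 𝓑) [F.Additive] [F.Linear K]
    (hF : ∀ ⦃X Y : CM 𝓐⦄ (f : X ⟶ Y), FactorsThroughProj f → FactorsThroughProj (F.map f))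
    {X Y : CM 𝓐} {f : X ⟶ Y} (hf : f ∈ projIdeal X Y) : F.map f ∈ projIdeal _ _ := by
  induction hf using Submodule.span_induction with
  | mem f hf => exact Submodule.subset_span (hF f hf)
  | zero => rw [F.map_zero]; exact zero_mem _
  | add f g _ _ hf hg => rw [F.map_add]; exact add_mem hf hg
  | smul c f _ hf => rw [F.map_smul]; exact Submodule.smul_mem _ c hf

/-- The functor on stable categories induced by a linear functor that preserves morphisms factoring
through projectives. -/
def mapFunctor (F : CM 𝓐 ⥤ CM 𝓑) [F.Additive] [F.Linear K]
    (hF : ∀ ⦃X Y : CM 𝓐⦄ (f : X ⟶ Y), FactorsThroughProj f → FactorsThroughProj (F.map f)) :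
    StableCM 𝓐 ⥤ StableCM 𝓑 :=
  CategoryTheory.Quotient.lift (stableRel 𝓐) (F ⋙ proj 𝓑) fun _ _ f g h =>
    (proj_map_eq_iff _ _).2 (by
      rw [← F.map_sub]
      exact map_mem_projIdeal F hF h)

section

variable (F : CM 𝓐 ⥤ CM 𝓑) [F.Additive] [F.Linear K]
  (hF : ∀ ⦃X Y : CM 𝓐⦄ (f : X ⟶ Y), FactorsThroughProj f → FactorsThroughProj (F.map f))

lemma mapFunctor_linear : (mapFunctor F hF).Linear K where
  map_smul := by
    rintro ⟨X⟩ ⟨Y⟩ ⟨f⟩ c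
    exact congrArg (proj 𝓑).map (F.map_smul c (show X ⟶ Y from f))

end

variable (E : CM 𝓐 ≌ CM 𝓑) [E.functor.Additive] [E.functor.Linear K] [E.inverse.Additive]
  [E.inverse.Linear K]
  (hF : ∀ ⦃X Y : CM 𝓐⦄ (f : X ⟶ Y), FactorsThroughProj f → FactorsThroughProj (E.functor.map f))
  (hG : ∀ ⦃X Y : CM 𝓑⦄ (f : X ⟶ Y), FactorsThroughProj f → FactorsThroughProj (E.inverse.map f))

/-- The equivalence of stable categories induced by an equivalence. -/
def mapEquivalence : StableCM 𝓐 ≌ StableCM 𝓑 :=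
  CategoryTheory.Equivalence.mk (mapFunctor E.functor hF) (mapFunctor E.inverse hG)
    (Quotient.natIsoLift _ (NatIso.ofComponents
      (fun X => show (proj 𝓐).obj X ≅ (proj 𝓐).obj (E.inverse.obj (E.functor.obj X)) from
        (proj 𝓐).mapIso (E.unitIso.app X))
      (fun f => congrArg (proj 𝓐).map (E.unitIso.hom.naturality f))))
    (Quotient.natIsoLift _ (NatIso.ofComponents
      (fun X => show (proj 𝓑).obj (E.functor.obj (E.inverse.obj X)) ≅ (proj 𝓑).obj X from
        (proj 𝓑).mapIso (E.counitIso.app X))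
      (fun f => congrArg (proj 𝓑).map (E.counitIso.hom.naturality f))))

end StableCM

namespace CM

lemma IsShortExact.comp_iso {X Y Z Z' : CM 𝓐} {f : X ⟶ Y} {g : Y ⟶ Z} (h : IsShortExact f g)
    (e : Z ≅ Z') : IsShortExact f (g ≫ e.hom) where
  injective := h.injective
  exact := fun y => by
    rw [← h.exact y]
    show lin e.hom (lin g y) = 0 ↔ _
    refine ⟨fun hy => ?_, fun hy => by rw [hy, map_zero]⟩
    have : lin e.inv (lin e.hom (lin g y)) = lin g y :=
      congrArg (fun k => lin k (lin g y)) e.hom_inv_id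
    rw [← this, hy, map_zero]
  surjective := fun z => by
    obtain ⟨y, hy⟩ := h.surjective (lin e.inv z)
    refine ⟨y, ?_⟩
    show lin e.hom (lin g y) = z
    rw [hy]
    exact congrArg (fun k => lin k z) e.inv_hom_id

namespace SyzygyChoice

lemma syzygyFunctor_map {σ : SyzygyChoice 𝓐} {Z Z' : CM 𝓐} {f : Z ⟶ Z'} {g : σ.Ω Z ⟶ σ.Ω Z'}
    (h : σ.IsInduced f g) :
    σ.syzygyFunctor.map ((StableCM.proj 𝓐).map f) = (StableCM.proj 𝓐).map g :=
  (σ.exists_isInduced f).choose_spec.proj_map_eq h (by rw [sub_self]; exact zero_mem _)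

variable (σ : SyzygyChoice 𝓐) (E : CM 𝓐 ≌ CM 𝓑)
  (hS : ∀ ⦃X Y Z : CM 𝓐⦄ (f : X ⟶ Y) (g : Y ⟶ Z), IsShortExact f g →
    IsShortExact (E.functor.map f) (E.functor.map g))
  (hP : ∀ X : CM 𝓐, X.obj.IsGrProjective → (E.functor.obj X).obj.IsGrProjective)

/-- The choice of syzygies that corresponds to `σ` under an exact equivalence. -/
def transport : SyzygyChoice 𝓑 where
  Ω Z := E.functor.obj (σ.Ω (E.inverse.obj Z))
  P Z := E.functor.obj (σ.P (E.inverse.obj Z))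
  ι Z := E.functor.map (σ.ι (E.inverse.obj Z))
  π Z := E.functor.map (σ.π (E.inverse.obj Z)) ≫ (E.counitIso.app Z).hom
  projective _ := hP _ (σ.projective _)
  exact _ := (hS _ _ (σ.exact _)).comp_iso _

variable {σ} in
lemma IsInduced.transport {Z Z' : CM 𝓑} {f : Z ⟶ Z'}
    {g : σ.Ω (E.inverse.obj Z) ⟶ σ.Ω (E.inverse.obj Z')} (h : σ.IsInduced (E.inverse.map f) g) :
    (σ.transport E hS hP).IsInduced f (E.functor.map g) := by
  obtain ⟨p, h1, h2⟩ := h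
  refine ⟨E.functor.map p, ?_, ?_⟩
  · show E.functor.map p ≫ E.functor.map _ ≫ E.counitIso.hom.app Z' =
      (E.functor.map _ ≫ E.counitIso.hom.app Z) ≫ f
    rw [← Functor.map_comp_assoc, h1, Functor.map_comp_assoc, Category.assoc]
    congr 1
    exact E.counitIso.hom.naturality f
  · show E.functor.map _ ≫ E.functor.map p = E.functor.map g ≫ E.functor.map _
    rw [← Functor.map_comp, h2, Functor.map_comp]

variable [E.functor.Additive] [E.functor.Linear K]
  (hF : ∀ ⦃X Y : CM 𝓐⦄ (f : X ⟶ Y), FactorsThroughProj f → FactorsThroughProj (E.functor.map f))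

lemma transport_syzygyFunctor_map {Z Z' : CM 𝓑} (f : Z ⟶ Z') :
    (σ.transport E hS hP).syzygyFunctor.map ((StableCM.proj 𝓑).map f) =
      (StableCM.mapFunctor E.functor hF).map
        (σ.syzygyFunctor.map ((StableCM.proj 𝓐).map (E.inverse.map f))) := by
  obtain ⟨g, hg⟩ := σ.exists_isInduced (E.inverse.map f)
  rw [syzygyFunctor_map hg, syzygyFunctor_map (hg.transport E hS hP)]
  rfl

/-- An exact equivalence commutes with the syzygy functors: the isomorphism is induced by the unit
`Z ⟶ E⁻¹ E Z`. -/
def transportIso : σ.syzygyFunctor ⋙ StableCM.mapFunctor E.functor hF ≅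
    StableCM.mapFunctor E.functor hF ⋙ (σ.transport E hS hP).syzygyFunctor :=
  Quotient.natIsoLift _ (NatIso.ofComponents
    (fun Z => show (StableCM.mapFunctor E.functor hF).obj
          (σ.syzygyFunctor.obj ((StableCM.proj 𝓐).obj Z)) ≅
        (StableCM.mapFunctor E.functor hF).obj
          (σ.syzygyFunctor.obj ((StableCM.proj 𝓐).obj (E.inverse.obj (E.functor.obj Z)))) from
      (StableCM.mapFunctor E.functor hF).mapIso (σ.syzygyFunctor.mapIso
        ((StableCM.proj 𝓐).mapIso (E.unitIso.app Z))))
    (fun {Z Z'} f => by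
      have h := transport_syzygyFunctor_map σ E hS hP hF (E.functor.map f)
      have h' : (StableCM.proj 𝓐).map f ≫ (StableCM.proj 𝓐).map (E.unitIso.hom.app Z') =
          (StableCM.proj 𝓐).map (E.unitIso.hom.app Z) ≫
            (StableCM.proj 𝓐).map (E.inverse.map (E.functor.map f)) :=
        congrArg (StableCM.proj 𝓐).map (E.unitIso.hom.naturality f)
      have h'' := congrArg
        (fun k => (StableCM.mapFunctor E.functor hF).map (σ.syzygyFunctor.map k)) h'
      simp only [Functor.map_comp] at h''
      rw [← h] at h''
      exact h''))

/-- An exact equivalence preserves distinguished triangles: a short exact sequence is mapped to a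
short exact sequence, and a connecting morphism `Ω Z ⟶ X` to its image composed with the comparison
of `Ω (E⁻¹ E Z)` with `Ω Z`. -/
lemma IsDistinguished.transport {X Y Z : StableCM 𝓐} {h : σ.syzygyFunctor.obj Z ⟶ X} {u : X ⟶ Y}
    {v : Y ⟶ Z} (H : σ.IsDistinguished h u v) :
    (σ.transport E hS hP).IsDistinguished
      ((transportIso σ E hS hP hF).inv.app Z ≫ (StableCM.mapFunctor E.functor hF).map h)
      ((StableCM.mapFunctor E.functor hF).map u) ((StableCM.mapFunctor E.functor hF).map v) := by
  obtain ⟨X', Y', Z', f, g, k, a, b, c, hfg, ⟨p, hp1, hp2⟩, e1, e2, e3⟩ := H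
  set S := StableCM.mapFunctor E.functor hF with hSdef
  -- the inverse of the unit compares the syzygies of `Z'` and of `E⁻¹ E Z'`
  obtain ⟨q, hq⟩ := σ.exists_isInduced
    (show E.inverse.obj (E.functor.obj Z') ⟶ Z' from E.unitIso.inv.app Z')
  have hz : (transportIso σ E hS hP hF).inv.app ((StableCM.proj 𝓐).obj Z') =
      S.map ((StableCM.proj 𝓐).map q) := congrArg S.map (syzygyFunctor_map hq)
  obtain ⟨r, hr1, hr2⟩ := hq
  refine ⟨E.functor.obj X', E.functor.obj Y', E.functor.obj Z', E.functor.map f, E.functor.map g,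
    E.functor.map (q ≫ k), S.mapIso a, S.mapIso b, S.mapIso c, hS _ _ hfg,
    ⟨E.functor.map (r ≫ p), ?_, ?_⟩, ?_, ?_, ?_⟩
  · show E.functor.map (r ≫ p) ≫ E.functor.map g = E.functor.map _ ≫ E.counit.app _
    rw [E.counit_app_functor, ← Functor.map_comp, ← Functor.map_comp, Category.assoc, hp1]
    exact congrArg E.functor.map hr1
  · have h1 : σ.ι _ ≫ r ≫ p = (q ≫ k) ≫ f := by
      rw [← Category.assoc, hr2, Category.assoc, hp2, Category.assoc]
    show E.functor.map _ ≫ E.functor.map (r ≫ p) = E.functor.map (q ≫ k) ≫ E.functor.map f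
    rw [← Functor.map_comp, ← Functor.map_comp]
    exact congrArg E.functor.map h1
  · have hn := (transportIso σ E hS hP hF).inv.naturality c.hom
    have e1' := (S.map_comp _ _).symm.trans ((congrArg S.map e1).trans (S.map_comp _ _))
    have hk : (transportIso σ E hS hP hF).inv.app ((StableCM.proj 𝓐).obj Z') ≫
        S.map ((StableCM.proj 𝓐).map k) = (StableCM.proj 𝓑).map (E.functor.map (q ≫ k)) := by
      rw [hz]
      exact (S.map_comp _ _).symm
    exact (comp_square hn e1').trans
      (congrArg (fun l => (σ.transport E hS hP).syzygyFunctor.map (S.map c.hom) ≫ l) hk)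
  · exact (S.map_comp _ _).symm.trans ((congrArg S.map e2).trans (S.map_comp _ _))
  · exact (S.map_comp _ _).symm.trans ((congrArg S.map e3).trans (S.map_comp _ _))

end SyzygyChoice

end CM

/-- A regrading induces a triangle equivalence of stable categories, as soon as syzygies exist. -/
lemma Regrading.stableTriangleEquivalent [GradedAlgebra 𝓐] [GradedAlgebra 𝓑]
    (R : Regrading 𝓐 𝓑) (σ : CM.SyzygyChoice 𝓐) : StableTriangleEquivalent 𝓐 𝓑 := by
  have : R.cmEquivalence.functor.Linear K := inferInstanceAs (R.cmFunctor.Linear K)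
  have : R.cmEquivalence.inverse.Linear K := inferInstanceAs (R.symm.cmFunctor.Linear K)
  have : R.cmEquivalence.functor.Additive := inferInstanceAs R.cmFunctor.Additive
  have : R.cmEquivalence.inverse.Additive := inferInstanceAs R.symm.cmFunctor.Additive
  have hF : ∀ ⦃X Y : CM 𝓐⦄ (f : X ⟶ Y), CM.FactorsThroughProj f →
    CM.FactorsThroughProj (R.cmEquivalence.functor.map f) := fun _ _ _ => R.factorsThroughProj_map
  have hG : ∀ ⦃X Y : CM 𝓑⦄ (f : X ⟶ Y), CM.FactorsThroughProj f →
    CM.FactorsThroughProj (R.cmEquivalence.inverse.map f) :=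
      fun _ _ _ => R.symm.factorsThroughProj_map
  have hS : ∀ ⦃X Y Z : CM 𝓐⦄ (f : X ⟶ Y) (g : Y ⟶ Z), CM.IsShortExact f g →
      CM.IsShortExact (R.cmEquivalence.functor.map f) (R.cmEquivalence.functor.map g) :=
    fun _ _ _ _ _ h => ⟨h.injective, h.exact, h.surjective⟩
  have hP : ∀ X : CM 𝓐, X.obj.IsGrProjective →
    (R.cmEquivalence.functor.obj X).obj.IsGrProjective := fun _ => R.isGrProjective_obj
  exact ⟨σ, σ.transport R.cmEquivalence hS hP, StableCM.mapEquivalence R.cmEquivalence hF hG,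
    CM.SyzygyChoice.transportIso σ R.cmEquivalence hS hP hF, StableCM.mapFunctor_linear _ hF,
    fun _ _ _ _ _ _ H => H.transport σ R.cmEquivalence hS hP hF⟩

end Transport

/-! ### Existence of syzygies over finite-dimensional graded algebras -/

section Syzygies

open MulOpposite

variable {K A : Type u} [Field K] [Ring A] [Algebra K A] {𝓐 : ℤ → Submodule K A}

namespace GrMod

/-- The kernel of a morphism of graded modules. -/
def ker {M N : GrMod 𝓐} (f : M ⟶ N) : GrMod 𝓐 where
  carrier := LinearMap.ker (Hom.lin f)
  gr := fun n => (M.gr n).comap ((LinearMap.ker (Hom.lin f)).subtype.restrictScalars K)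
  isInternal := by
    have hmem : ∀ n, ∀ x ∈ (LinearMap.ker (Hom.lin f)).restrictScalars K,
        M.proj n x ∈ (LinearMap.ker (Hom.lin f)).restrictScalars K := by
      intro n x hx
      show Hom.lin f (M.proj n x) = 0
      rw [← Hom.proj_comm, show Hom.lin f x = 0 from hx, map_zero]
    refine isInternal_of_proj _ (fun n => (M.proj n).restrict (hmem n)) ?_ ?_ ?_
    · intro n x hx
      exact Subtype.ext (M.proj_of_mem hx)
    · intro n m hmn x hx
      exact Subtype.ext (M.proj_of_mem_ne hx hmn)
    · rw [eq_top_iff]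
      rintro ⟨x, hx⟩ -
      classical
      let _ := M.isInternal.chooseDecomposition
      have hsum : (⟨x, hx⟩ : LinearMap.ker (Hom.lin f)) =
          ∑ n ∈ (DirectSum.decompose M.gr x).support, ⟨M.proj n x, hmem n x hx⟩ := by
        refine Subtype.ext ?_
        rw [AddSubmonoidClass.coe_finsetSum]
        exact (DirectSum.sum_support_decompose M.gr x).symm
      rw [hsum]
      exact sum_mem fun n _ => Submodule.mem_iSup_of_mem n (M.proj_mem n x)
  smul_mem := fun ha hx => M.smul_mem ha hx

/-- The inclusion of the kernel. -/
def kerι {M N : GrMod 𝓐} (f : M ⟶ N) : ker f ⟶ M :=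
  Hom.mk (M := ker f) (N := M) (LinearMap.ker (Hom.lin f)).subtype fun _ _ hx => hx

/-- The graded free module with a basis whose elements have the given degrees. -/
def free [GradedAlgebra 𝓐] {ι : Type u} [Fintype ι] (deg : ι → ℤ) : GrMod 𝓐 where
  carrier := ι → A
  gr := fun n => Submodule.pi Set.univ fun j => 𝓐 (n - deg j)
  isInternal := by
    classical
    refine isInternal_of_proj _ (fun n => LinearMap.pi fun j =>
      GradedAlgebra.proj 𝓐 (n - deg j) ∘ₗ LinearMap.proj j) ?_ ?_ ?_
    · intro n x hx
      exact funext fun j => Reflection.proj_of_mem 𝓐 (hx j trivial)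
    · intro n m hmn x hx
      exact funext fun j => Reflection.proj_of_mem_ne 𝓐 (hx j trivial) (by omega)
    · rw [eq_top_iff]
      rintro x -
      rw [← Finset.univ_sum_single x]
      refine sum_mem fun j _ => ?_
      have h : (⨆ n, 𝓐 n) ≤ (⨆ n, Submodule.pi Set.univ fun j => 𝓐 (n - deg j)).comap
          (LinearMap.single K (fun _ => A) j) := by
        refine iSup_le fun n a ha => Submodule.mem_iSup_of_mem (n + deg j) fun k _ => ?_
        rw [LinearMap.coe_single]
        by_cases hk : k = j
        · subst hk
          show (Pi.single k a : ι → A) k ∈ 𝓐 (n + deg k - deg k)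
          rw [Pi.single_eq_same, add_sub_cancel_right]
          exact ha
        · rw [Pi.single_eq_of_ne hk]
          exact zero_mem _
      exact h (show x j ∈ ⨆ n, 𝓐 n by rw [iSup_eq_top_of_graded]; trivial)
  smul_mem := by
    intro m n a x ha hx j _
    show x j * a ∈ 𝓐 (n + m - deg j)
    rw [show n + m - deg j = n - deg j + m by ring]
    exact SetLike.mul_mem_graded (hx j trivial) ha

variable [GradedAlgebra 𝓐] {ι : Type u} [Fintype ι] {deg : ι → ℤ}

/-- The morphism from a graded free module that is determined by homogeneous elements of the right
degrees. -/
def freeHom {M : GrMod 𝓐} (y : ι → M) (hy : ∀ j, y j ∈ M.gr (deg j)) : free (𝓐 := 𝓐) deg ⟶ M :=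
  Hom.mk (M := free deg) (N := M)
    { toFun := fun x : ι → A => ∑ j, op (x j) • y j
      map_add' := fun x x' => by
        rw [← Finset.sum_add_distrib]
        exact Finset.sum_congr rfl fun j _ => add_smul (op (x j)) (op (x' j)) (y j)
      map_smul' := fun a x => by
        rw [RingHom.id_apply, Finset.smul_sum]
        exact Finset.sum_congr rfl fun j _ => mul_smul a (op (x j)) (y j) }
    (fun n x hx => sum_mem fun j _ => by
      rw [show n = deg j + (n - deg j) by ring]
      exact M.smul_mem (hx j trivial) (hy j))

lemma freeHom_apply {M : GrMod 𝓐} (y : ι → M) (hy : ∀ j, y j ∈ M.gr (deg j)) (x : ι → A) :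
    Hom.lin (freeHom (deg := deg) y hy) x = ∑ j, op (x j) • y j := rfl

open Classical in
lemma freeHom_single {M : GrMod 𝓐} (y : ι → M) (hy : ∀ j, y j ∈ M.gr (deg j)) (j : ι) :
    Hom.lin (freeHom (deg := deg) y hy) (Pi.single j (1 : A)) = y j := by
  rw [freeHom_apply, Finset.sum_eq_single j]
  · rw [Pi.single_eq_same, op_one, one_smul]
  · intro k _ hk
    rw [Pi.single_eq_of_ne hk, op_zero, zero_smul]
  · simp

open Classical in
lemma single_mem_free (j : ι) :
    (Pi.single j (1 : A) : ι → A) ∈ (free (𝓐 := 𝓐) deg).gr (deg j) := by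
  intro k _
  by_cases hk : k = j
  · subst hk
    show (Pi.single k 1 : ι → A) k ∈ 𝓐 (deg k - deg k)
    rw [Pi.single_eq_same, sub_self]
    exact SetLike.one_mem_graded 𝓐
  · rw [Pi.single_eq_of_ne hk]
    exact zero_mem _

open Classical in
lemma free_hom_apply {M : GrMod 𝓐} (f : free (𝓐 := 𝓐) deg ⟶ M) (x : ι → A) :
    Hom.lin f x = ∑ j, op (x j) • Hom.lin f (Pi.single j (1 : A)) := by
  have h : x = ∑ j, op (x j) • (Pi.single j (1 : A) : ι → A) := by
    refine (Finset.univ_sum_single x).symm.trans (Finset.sum_congr rfl fun j _ => ?_)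
    rw [← Pi.single_smul, op_smul_eq_mul, one_mul]
  refine (congrArg (Hom.lin f) h).trans ((map_sum (Hom.lin f) _ _).trans ?_)
  exact Finset.sum_congr rfl fun j _ => (Hom.lin f).map_smul _ _

lemma free_isGrProjective : (free (𝓐 := 𝓐) deg).IsGrProjective := by
  classical
  intro M N g f hg
  have hex : ∀ j, ∃ y ∈ M.gr (deg j), Hom.lin g y = Hom.lin f (Pi.single j (1 : A)) := by
    intro j
    obtain ⟨y, hy⟩ := hg (Hom.lin f (Pi.single j (1 : A)))
    refine ⟨M.proj (deg j) y, M.proj_mem _ _, ?_⟩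
    rw [← Hom.proj_comm, hy]
    exact N.proj_of_mem (Hom.mem f (single_mem_free j))
  choose y hy hy' using hex
  refine ⟨freeHom y hy, Hom.ext fun x => ?_⟩
  refine Eq.trans ?_ (free_hom_apply f x).symm
  refine (map_sum (Hom.lin g) _ _).trans ?_
  exact Finset.sum_congr rfl fun j _ => by rw [map_smul, hy']

end GrMod

/-- A ring is a free right module over itself. -/
def selfOpEquiv (A : Type u) [Ring A] : A ≃ₗ[Aᵐᵒᵖ] Aᵐᵒᵖ :=
  { opAddEquiv with map_smul' := fun _ _ => rfl }

namespace GrMod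

instance : Module.Free Aᵐᵒᵖ A := Module.Free.of_equiv (selfOpEquiv A).symm

instance : Module.Finite Aᵐᵒᵖ A := Module.Finite.equiv (selfOpEquiv A).symm

lemma free_isCM [GradedAlgebra 𝓐] {ι : Type u} [Fintype ι] (deg : ι → ℤ) :
    isCM 𝓐 (free deg) := by
  refine ⟨inferInstanceAs (Module.Finite Aᵐᵒᵖ (ι → A)), fun n hn => ?_⟩
  obtain ⟨n, rfl⟩ := Nat.exists_eq_succ_of_ne_zero hn.ne'
  have : Projective (ModuleCat.of Aᵐᵒᵖ (ι → A)) := inferInstance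
  exact Abelian.Ext.subsingleton_of_projective (ModuleCat.of Aᵐᵒᵖ (ι → A)) _ n

/-- Dimension shifting: the first syzygy of a Cohen-Macaulay module is Cohen-Macaulay. -/
lemma ker_isCM [IsNoetherianRing Aᵐᵒᵖ] {P Z : GrMod 𝓐} (hP : isCM 𝓐 P) (hZ : isCM 𝓐 Z) (f : P ⟶ Z)
    (hf : Function.Surjective (Hom.lin f)) : isCM 𝓐 (ker f) := by
  have : Module.Finite Aᵐᵒᵖ P.carrier := hP.1
  refine ⟨inferInstanceAs (Module.Finite Aᵐᵒᵖ (LinearMap.ker (Hom.lin f))), fun n hn => ?_⟩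
  have hS := LinearMap.shortExact_shortComplexKer hf
  refine subsingleton_of_forall_eq 0 fun x => ?_
  have := hZ.2 (1 + n) (by omega)
  obtain ⟨y, rfl⟩ := Abelian.Ext.contravariant_sequence_exact₁ hS _ x rfl (Subsingleton.elim _ _)
  have := hP.2 n hn
  rw [Subsingleton.elim y 0]
  exact Abelian.Ext.comp_zero _ _ _ _ _

/-- A finitely generated graded module is a quotient of a finitely generated graded free module. -/
lemma exists_free_surjective [GradedAlgebra 𝓐] {M : GrMod 𝓐} (hM : M.IsFG) :
    ∃ (ι : Type u) (_ : Fintype ι) (deg : ι → ℤ) (f : free (𝓐 := 𝓐) deg ⟶ M),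
      Function.Surjective (Hom.lin f) := by
  classical
  have hspan : Submodule.span Aᵐᵒᵖ {x : M.carrier | ∃ n, x ∈ M.gr n} = ⊤ := by
    have h : ⨆ n, M.gr n ≤
        (Submodule.span Aᵐᵒᵖ {x : M.carrier | ∃ n, x ∈ M.gr n}).restrictScalars K :=
      iSup_le fun n x hx => Submodule.subset_span ⟨n, hx⟩
    rw [iSup_gr] at h
    exact eq_top_iff.2 fun x _ => h trivial
  obtain ⟨s, hs, hs'⟩ := (Submodule.fg_span_iff_fg_span_finset_subset _).1
    (hspan ▸ hM.fg_top : (Submodule.span Aᵐᵒᵖ {x : M.carrier | ∃ n, x ∈ M.gr n}).FG)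
  choose deg hdeg using fun x : s => hs x.2
  refine ⟨s, inferInstance, deg, freeHom (fun x => x.1) hdeg, ?_⟩
  rw [← LinearMap.range_eq_top, eq_top_iff, ← hspan, hs', Submodule.span_le]
  intro x hx
  exact ⟨_, freeHom_single (fun x : s => x.1) hdeg ⟨x, hx⟩⟩

end GrMod

/-- Over a Noetherian graded algebra, every Cohen-Macaulay module has a syzygy. -/
lemma nonempty_syzygyChoice [GradedAlgebra 𝓐] [IsNoetherianRing Aᵐᵒᵖ] :
    Nonempty (CM.SyzygyChoice 𝓐) := by
  have h : ∀ Z : CM 𝓐, ∃ (ΩZ PZ : CM 𝓐) (ι : ΩZ ⟶ PZ) (π : PZ ⟶ Z),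
      PZ.obj.IsGrProjective ∧ CM.IsShortExact ι π := by
    intro Z
    obtain ⟨ι, _, deg, f, hf⟩ := GrMod.exists_free_surjective Z.property.1
    refine ⟨⟨GrMod.ker f, GrMod.ker_isCM (GrMod.free_isCM deg) Z.property f hf⟩,
      ⟨GrMod.free deg, GrMod.free_isCM deg⟩, ObjectProperty.homMk (GrMod.kerι f),
      ObjectProperty.homMk f, GrMod.free_isGrProjective, Subtype.val_injective, fun y => ?_, hf⟩
    exact ⟨fun hy => ⟨⟨y, hy⟩, rfl⟩, by rintro ⟨y, rfl⟩; exact y.2⟩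
  choose Ω P ι π h1 h2 using h
  exact ⟨⟨Ω, P, ι, π, h1, h2⟩⟩

end Syzygies

/-! ### Truncated preprojective algebras are finite-dimensional -/

section FiniteDimensional

variable {V : Type u} [Fintype V] {K : Type u} [Field K] {Q : Quiver.{u} V}

lemma mk_ofArrow_mem (hQ : IsAcyclic Q) (i : V) {a b : V} (α : (doubleQuiver Q).Hom a b) :
    Ideal.Quotient.mkₐ K (preprojectiveIdeal K Q) (ofArrow K (doubleQuiver Q) α) ∈
      twoSidedSpan {1 - idem K Q i} := by
  have hi : 1 - idem K Q i ∈ twoSidedSpan {1 - idem K Q i} :=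
    mem_twoSidedSpan.2 (TwoSidedIdeal.subset_span rfl)
  -- the double quiver has no loops, so that `a` or `b` differs from `i`
  have hab : a ≠ b := by
    rintro rfl
    rcases α with α | α
    all_goals
      have := hQ a (@Quiver.Path.cons V Q a a a .nil α)
      cases this
  by_cases hb : b = i
  · have ha : i ≠ a := fun h => hab (by rw [hb, h])
    have h0 : vertexIdem K (doubleQuiver Q) i * ofArrow K (doubleQuiver Q) α = 0 := by
      rw [← vertexIdem_mul_ofArrow α, ← mul_assoc, vertexIdem_mul_of_ne ha, zero_mul]
    have h := Ideal.mul_mem_right (Ideal.Quotient.mkₐ K (preprojectiveIdeal K Q)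
      (ofArrow K (doubleQuiver Q) α)) _ hi
    have h1 : idem K Q i * Ideal.Quotient.mkₐ K (preprojectiveIdeal K Q)
        (ofArrow K (doubleQuiver Q) α) = 0 := by
      rw [idem, ← map_mul, h0, map_zero]
    rwa [sub_mul, one_mul, h1, sub_zero] at h
  · have h0 : ofArrow K (doubleQuiver Q) α * vertexIdem K (doubleQuiver Q) i = 0 := by
      rw [← ofArrow_mul_vertexIdem α, mul_assoc, vertexIdem_mul_of_ne hb, mul_zero]
    have h := Ideal.mul_mem_left _ (Ideal.Quotient.mkₐ K (preprojectiveIdeal K Q)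
      (ofArrow K (doubleQuiver Q) α)) hi
    have h1 : Ideal.Quotient.mkₐ K (preprojectiveIdeal K Q) (ofArrow K (doubleQuiver Q) α) *
        idem K Q i = 0 := by
      rw [idem, ← map_mul, h0, map_zero]
    rwa [mul_sub, mul_one, h1, sub_zero] at h

/-- Every arrow lies in every ideal `I_i`, so that paths of length at least `r` lie in the product
of `r` such ideals. -/
lemma mk_ofPath_mem (hQ : IsAcyclic Q) (ω : List V) {a b : V}
    (p : @Quiver.Path V (doubleQuiver Q) a b)
    (hp : ω.length ≤ @Quiver.Path.length V (doubleQuiver Q) a b p) :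
    Ideal.Quotient.mkₐ K (preprojectiveIdeal K Q) (ofPath K (doubleQuiver Q) ⟨a, b, p⟩) ∈
      wordIdeal K Q ω := by
  induction ω generalizing a with
  | nil => trivial
  | cons i ω ih =>
    obtain ⟨n, hn⟩ : ∃ n, @Quiver.Path.length V (doubleQuiver Q) a b p = n + 1 :=
      ⟨_, (Nat.succ_pred (by rw [List.length_cons] at hp; omega)).symm⟩
    obtain ⟨c, α, q, hq, rfl⟩ :=
      @Quiver.Path.eq_toPath_comp_of_length_eq_succ V (doubleQuiver Q) a b p n hn
    have h : ofPath K (doubleQuiver Q) ⟨a, b, @Quiver.Path.comp V (doubleQuiver Q) _ _ _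
        (@Quiver.Hom.toPath V (doubleQuiver Q) _ _ α) q⟩ =
          ofArrow K (doubleQuiver Q) α * ofPath K (doubleQuiver Q) ⟨c, b, q⟩ := by
      rw [ofArrow, mul_eq_mulLin, mulLin_ofPath, pathMul_of_eq]
    rw [h, map_mul]
    rw [List.length_cons, hn] at hp
    exact Ideal.mul_mem_mul (mk_ofArrow_mem hQ i α) (ih q (by omega))

variable (K Q) in
/-- The space of linear combinations of trivial paths and arrows of the double quiver. -/
def shortPaths : Submodule K (PathAlgebra K (doubleQuiver Q)) :=
  Submodule.span K (Set.range (vertexIdem K (doubleQuiver Q)) ∪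
    Set.range fun α : Σ a b : V, (doubleQuiver Q).Hom a b => ofArrow K (doubleQuiver Q) α.2.2)

lemma ofPath_mem_shortPaths_pow {n : ℕ} {a b : V} (p : @Quiver.Path V (doubleQuiver Q) a b)
    (hp : @Quiver.Path.length V (doubleQuiver Q) a b p ≤ n) :
    ofPath K (doubleQuiver Q) ⟨a, b, p⟩ ∈ shortPaths K Q ^ (n + 1) := by
  induction p generalizing n with
  | nil =>
    have h := Submodule.pow_mem_pow (shortPaths K Q)
      (Submodule.subset_span (Or.inl ⟨a, rfl⟩) : vertexIdem K (doubleQuiver Q) a ∈ _) (n + 1)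
    rwa [IsIdempotentElem.pow_succ_eq n (vertexIdem_mul_self a)] at h
  | @cons c d p α ih =>
    have hp' : @Quiver.Path.length V (doubleQuiver Q) a c p + 1 ≤ n := hp
    obtain ⟨k, rfl⟩ : ∃ k, n = k + 1 := ⟨n - 1, by omega⟩
    rw [ofPath_cons, pow_succ]
    exact Submodule.mul_mem_mul (ih (by omega)) (Submodule.subset_span (Or.inr ⟨⟨c, d, α⟩, rfl⟩))

/-- The truncated preprojective algebra is spanned by the paths that are shorter than the word. -/
lemma finite_truncated [∀ a b : V, Finite (Q.Hom a b)] (hQ : IsAcyclic Q) (ω : List V) :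
    Module.Finite K (Truncated K Q ω) := by
  have hfin : ∀ a b : V, Finite ((doubleQuiver Q).Hom a b) := fun a b =>
    inferInstanceAs (Finite (Q.Hom a b ⊕ Q.Hom b a))
  have hfg : (shortPaths K Q).FG :=
    Submodule.fg_span ((Set.finite_range _).union (Set.finite_range _))
  refine ⟨?_⟩
  have htop : (⊤ : Submodule K (Truncated K Q ω)) =
      (shortPaths K Q ^ (ω.length + 1)).map (toTruncated K Q ω).toLinearMap := by
    rw [eq_comm, eq_top_iff]
    rintro x -
    obtain ⟨x, rfl⟩ := Ideal.Quotient.mk_surjective x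
    obtain ⟨x, rfl⟩ := Ideal.Quotient.mk_surjective x
    have hspan : Submodule.span K (Set.range (ofPath K (doubleQuiver Q))) = ⊤ :=
      (Finsupp.basisSingleOne (R := K) (ι := AllPaths (doubleQuiver Q))).span_eq ▸ by congr 1
    have hx : x ∈ Submodule.span K (Set.range (ofPath K (doubleQuiver Q))) := by
      rw [hspan]
      trivial
    suffices h : Submodule.span K (Set.range (ofPath K (doubleQuiver Q))) ≤
        ((shortPaths K Q ^ (ω.length + 1)).map (toTruncated K Q ω).toLinearMap).comap
          (toTruncated K Q ω).toLinearMap from h hx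
    rw [Submodule.span_le]
    rintro _ ⟨⟨a, b, p⟩, rfl⟩
    rcases le_total (@Quiver.Path.length V (doubleQuiver Q) a b p) ω.length with h | h
    · exact ⟨_, ofPath_mem_shortPaths_pow p h, rfl⟩
    · have h0 : toTruncated K Q ω (ofPath K (doubleQuiver Q) ⟨a, b, p⟩) = 0 :=
        Ideal.Quotient.eq_zero_iff_mem.2 (mk_ofPath_mem hQ ω p h)
      rw [SetLike.mem_coe, Submodule.mem_comap, AlgHom.toLinearMap_apply, h0]
      exact zero_mem _
  rw [htop]
  exact (hfg.pow _).map _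

lemma isNoetherianRing_op (K : Type u) {A : Type u} [Field K] [Ring A] [Algebra K A]
    [Module.Finite K A] : IsNoetherianRing Aᵐᵒᵖ := by
  have : Module.Finite K Aᵐᵒᵖ := Module.Finite.equiv (MulOpposite.opLinearEquiv K)
  exact isNoetherianRing_iff.2 (isNoetherian_of_tower K inferInstance)

end FiniteDimensional

/-! ### The endomorphism algebra of `e A(d) ⊕ (1 - e) A` -/

section Endomorphisms

open MulOpposite

variable {K A : Type u} [Field K] [Ring A] [Algebra K A] {𝓐 : ℤ → Submodule K A} [GradedAlgebra 𝓐]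
  {e : A} (he : e ∈ 𝓐 0)

/-- The graded right module `e A(d) ⊕ (1 - e) A`. -/
def shiftedSum (d : ℤ) : GrMod 𝓐 :=
  GrMod.prod (GrMod.shift d (GrMod.rightIdeal e he))
    (GrMod.rightIdeal (1 - e) (sub_mem (SetLike.one_mem_graded 𝓐) he))

lemma mul_eq_self_of_mem_span {f x : A} (hf : IsIdempotentElem f)
    (hx : x ∈ Submodule.span Aᵐᵒᵖ {f}) : f * x = x := by
  obtain ⟨a, rfl⟩ := Submodule.mem_span_singleton.1 hx
  show f * (f * a.unop) = f * a.unop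
  rw [← mul_assoc, hf]

/-- As an ungraded module, `e A(d) ⊕ (1 - e) A` is `A`. -/
def shiftedSumEquiv (hee : IsIdempotentElem e) (d : ℤ) : shiftedSum he d ≃ₗ[Aᵐᵒᵖ] A where
  toFun := fun x : Submodule.span Aᵐᵒᵖ {e} × Submodule.span Aᵐᵒᵖ {1 - e} => x.1 + x.2
  map_add' := fun (x y : Submodule.span Aᵐᵒᵖ {e} × Submodule.span Aᵐᵒᵖ {1 - e}) =>
    add_add_add_comm (x.1 : A) y.1 x.2 y.2
  map_smul' := fun a (x : Submodule.span Aᵐᵒᵖ {e} × Submodule.span Aᵐᵒᵖ {1 - e}) =>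
    (smul_add a (x.1 : A) x.2).symm
  invFun := fun a => show Submodule.span Aᵐᵒᵖ {e} × Submodule.span Aᵐᵒᵖ {1 - e} from
    (⟨e * a, Submodule.mem_span_singleton.2 ⟨op a, rfl⟩⟩,
      ⟨(1 - e) * a, Submodule.mem_span_singleton.2 ⟨op a, rfl⟩⟩)
  left_inv := by
    rintro ⟨⟨x, hx⟩, ⟨y, hy⟩⟩
    have h1 := mul_eq_self_of_mem_span hee hx
    have h2 := mul_eq_self_of_mem_span hee.one_sub hy
    have h3 : (1 - e) * x = 0 := by rw [sub_mul, one_mul, h1, sub_self]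
    have h4 : e * y = 0 := by
      rw [sub_mul, one_mul] at h2
      exact sub_eq_self.1 h2
    refine Prod.ext (Subtype.ext ?_) (Subtype.ext ?_)
    · show e * (x + y) = x
      rw [mul_add, h1, h4, add_zero]
    · show (1 - e) * (x + y) = y
      rw [mul_add, h2, h3, zero_add]
  right_inv := fun a => by
    show e * a + (1 - e) * a = a
    rw [← add_mul, add_sub_cancel, one_mul]

lemma mem_shiftedSum_gr (hee : IsIdempotentElem e) (d k : ℤ) (a : A) :
    (shiftedSumEquiv he hee d).symm a ∈ (shiftedSum he d).gr k ↔
      e * a ∈ 𝓐 (k + d) ∧ (1 - e) * a ∈ 𝓐 k := Iff.rfl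

/-- `A` acts on `e A(d) ⊕ (1 - e) A` by left multiplication. -/
def endEquiv (hee : IsIdempotentElem e) (d : ℤ) :
    A ≃ₐ[K] Module.End Aᵐᵒᵖ (shiftedSum he d) :=
  (AlgEquiv.moduleEndSelfOp K (A := A)).trans ((shiftedSumEquiv he hee d).symm.conjAlgEquiv K)

lemma endEquiv_apply (hee : IsIdempotentElem e) (d : ℤ) (a b : A) :
    endEquiv (K := K) he hee d a ((shiftedSumEquiv he hee d).symm b) =
      (shiftedSumEquiv he hee d).symm (a * b) := by
  show (shiftedSumEquiv he hee d).symm (a * (shiftedSumEquiv he hee d)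
    ((shiftedSumEquiv he hee d).symm b)) = _
  rw [LinearEquiv.apply_symm_apply]

/-- Left multiplication by `a` is homogeneous of degree `n` on `e A(d) ⊕ (1 - e) A` if and only if
it is homogeneous on the generators `e` and `1 - e`, which have degrees `-d` and `0`. -/
lemma endEquiv_mem_iff (hee : IsIdempotentElem e) (d n : ℤ) (a : A) :
    a ∈ regrade 𝓐 e d n ↔ endEquiv he hee d a ∈ (shiftedSum he d).endGrading n := by
  have ho := hee.one_sub
  have heo : e * (1 - e) = 0 := by rw [mul_sub, mul_one, hee, sub_self]
  have hoe : (1 - e) * e = 0 := by rw [sub_mul, one_mul, hee, sub_self]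
  constructor
  · rintro ⟨h1, h2, h3, h4⟩ k x hx
    obtain ⟨b, rfl⟩ := (shiftedSumEquiv he hee d).symm.surjective x
    obtain ⟨k1, k2⟩ := (mem_shiftedSum_gr he hee d k b).1 hx
    rw [endEquiv_apply, mem_shiftedSum_gr]
    have split : ∀ f : A, f * (a * b) = f * a * e * (e * b) + f * a * (1 - e) * ((1 - e) * b) := by
      intro f
      rw [mul_assoc (f * a), ← mul_assoc e e, hee, mul_assoc (f * a), ← mul_assoc (1 - e) (1 - e),
        ho, ← mul_add, ← add_mul, add_sub_cancel, one_mul, mul_assoc]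
    rw [split e, split (1 - e)]
    refine ⟨add_mem ?_ ?_, add_mem ?_ ?_⟩
    · rw [show k + n + d = n + (k + d) by ring]
      exact SetLike.mul_mem_graded h1 k1
    · rw [show k + n + d = n + d + k by ring]
      exact SetLike.mul_mem_graded h3 k2
    · rw [show k + n = n - d + (k + d) by ring]
      exact SetLike.mul_mem_graded h4 k1
    · rw [show k + n = n + k by ring]
      exact SetLike.mul_mem_graded h2 k2
  · intro h
    have h1 := h (-d) _ ((mem_shiftedSum_gr he hee d (-d) e).2
      ⟨by rw [hee, neg_add_cancel]; exact he, by rw [hoe]; exact zero_mem _⟩)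
    have h2 := h 0 _ ((mem_shiftedSum_gr he hee d 0 (1 - e)).2
      ⟨by rw [heo]; exact zero_mem _,
        by rw [ho]; exact sub_mem (SetLike.one_mem_graded 𝓐) he⟩)
    rw [endEquiv_apply, mem_shiftedSum_gr, ← mul_assoc, ← mul_assoc] at h1 h2
    rw [show -d + n + d = n by ring, show -d + n = n - d by ring] at h1
    rw [zero_add] at h2
    exact ⟨h1.1, h2.2, h2.1, h1.2⟩

end Endomorphisms

/-! ### Coxeter groups -/

section Coxeter

variable {V : Type u}

/-- Reversing arrows does not change the number of arrows between two vertices. -/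
lemma coxeterMatrix_sinkReflection (Q : Quiver.{u} V) (i : V) :
    coxeterMatrix (sinkReflection Q i) = coxeterMatrix Q := by
  ext a b
  have h : Nat.card ((sinkReflection Q i).Hom a b ⊕ (sinkReflection Q i).Hom b a) =
      Nat.card (Q.Hom a b ⊕ Q.Hom b a) := Nat.card_congr (reflectArrow Q i a b)
  simp only [coxeterMatrix]
  rw [h]

lemma exists_coxeterGroup_mulEquiv {M M' : CoxeterMatrix V} (h : M' = M) :
    ∃ φ : M.Group ≃* M'.Group, (∀ j, φ (M.simple j) = M'.simple j) ∧
      ∀ (w : M.Group) (ω : List V),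
        M.toCoxeterSystem.wordProd ω = w ∧ M.toCoxeterSystem.IsReduced ω →
          M'.toCoxeterSystem.wordProd ω = φ w ∧ M'.toCoxeterSystem.IsReduced ω := by
  subst h
  exact ⟨MulEquiv.refl _, fun _ => rfl, fun _ _ h => h⟩

end Coxeter

/-- At a sink `i`, the isomorphism `Π(σ_i Q)_w ≅ Π(Q)_w` shifts degrees by `1` at `e_i`. -/
def reflectRegrading (K : Type u) [Field K] {V : Type u} [Fintype V] (Q : Quiver.{u} V)
    [∀ a b : V, Finite (Q.Hom a b)] {i : V} (hi : IsSink Q i) (ω : List V) :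
    Regrading (truncatedGrading K Q ω) (truncatedGrading K (sinkReflection Q i) ω) where
  Φ := reflectTruncated K Q i ω
  e := truncatedIdem K Q ω i
  d := 1
  isIdempotentElem := isIdempotentElem_truncatedIdem ω
  e_mem := truncatedIdem_mem K Q ω i
  symm_e_mem := by
    rw [reflectTruncated, truncatedEquiv_symm_idem]
    exact truncatedIdem_mem K _ ω i
  map_mem := truncatedEquiv_mem_regrade _ _ _ ω i 1 (reflectEquiv_mem_regrade hi)
  symm_map_mem := by
    rw [reflectTruncated, truncatedEquiv_symm_idem]
    exact truncatedEquiv_symm_mem_regrade _ _ _ ω i (-1) (reflectEquiv_symm_mem_regrade hi)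

end Reflection
end

open Reflection in
theorem mainTheorem7 {K : Type u} [Field K] {V : Type u} [Fintype V] (Q : Quiver.{u} V)
    [∀ a b : V, Finite (Q.Hom a b)] (hQ : IsAcyclic Q) (i : V) (hi : IsSink Q i) :
    ∃ φ : CoxeterGroup Q ≃* CoxeterGroup (sinkReflection Q i),
      (∀ j : V, φ ((coxeterMatrix Q).simple j) = (coxeterMatrix (sinkReflection Q i)).simple j) ∧
      ∀ (w : CoxeterGroup Q) (ω : List V), IsReducedExpression Q w ω →
        IsReducedExpression (sinkReflection Q i) (φ w) ω ∧
        (∃ ψ : Truncated K (sinkReflection Q i) ω ≃ₐ[K]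
            Module.End (Truncated K Q ω)ᵐᵒᵖ (shiftedProgenerator K Q ω i),
          ∀ (n : ℤ) (b : Truncated K (sinkReflection Q i) ω),
            b ∈ truncatedGrading K (sinkReflection Q i) ω n ↔
              ψ b ∈ (shiftedProgenerator K Q ω i).endGrading n) ∧
        GradedMoritaEquivalent (truncatedGrading K Q ω)
          (truncatedGrading K (sinkReflection Q i) ω) ∧
        StableTriangleEquivalent (truncatedGrading K Q ω)
          (truncatedGrading K (sinkReflection Q i) ω) := by
  obtain ⟨φ, hφ, hφ'⟩ := exists_coxeterGroup_mulEquiv (coxeterMatrix_sinkReflection Q i)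
  refine ⟨φ, hφ, fun w ω hω => ⟨hφ' w ω hω, ?_, ?_, ?_⟩⟩
  · exact ⟨(reflectTruncated K Q i ω).trans
      (endEquiv (truncatedIdem_mem K Q ω i) (isIdempotentElem_truncatedIdem ω) 1), fun n b =>
        ((reflectRegrading K Q hi ω).map_mem_iff n b).trans
          (endEquiv_mem_iff (truncatedIdem_mem K Q ω i) (isIdempotentElem_truncatedIdem ω) 1 n _)⟩
  · exact (reflectRegrading K Q hi ω).gradedMoritaEquivalent
  · have := finite_truncated (K := K) hQ ω
    have := isNoetherianRing_op K (A := Truncated K Q ω)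
    exact (reflectRegrading K Q hi ω).stableTriangleEquivalent nonempty_syzygyChoice.some
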